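/- Let $E$ be a finite-dimensional real vector space, $\|\cdot\|$ a norm on $E$, and $\kappa\ge 1$. The norm $\|\cdot\|$ is called $\kappa$-smooth if $p(x)=\|x\|^2$ is continuously differentiable on $E$ and $$p(x+y)\le p(x)+Dp(x)[y]+\kappa\,p(y)\qquad\text{for all }x,y\in E.$$ It is called $\kappa$-regular if there exist $\kappa_+\in[1,\kappa]$ and a $\kappa_+$-smooth norm $\|\cdot\|_+$ on $E$ with $$\|x\|^2\le\|x\|_+^2\le\frac{\kappa}{\kappa_+}\|x\|^2\qquad\text{for all }x\in E.$$ For a real $m\times n$ matrix $X$ let $|X|_p=\|\sigma(X)\|_p$, where $\sigma(X)\in\mathbb{R}^{\min(m,n)}$ is the vector of singular values of $X$. (a) Let $m,n\ge 1$ and $2\le p\le\infty$. Then the minimum $$\kappa_p(m,n)=\min_{2\le\rho<\infty,\ \rho\le p}\ \max[2,\rho-1]\,(\min(m,n))^{\frac{2}{\rho}-\frac{2}{p}}$$ (with $2/\infty=0$) is attained, $|\cdot|_p$ is a $\kappa_p(m,n)$-regular norm on the space $\mathbb{R}^{m\times n}$ of real $m\times n$ matrices, and $$\kappa_p(m,n)\le\min\bigl[\max[2,p-1],\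 (2\ln(\min(m,n)+2)-1)\,e\bigr],$$ where $\max[2,p-1]=\infty$ if $p=\infty$. (b) Let $n\ge 1$ and $2\le\rho<\infty$. Then $|\cdot|_\rho$ is a $\max[2,\rho-1]$-smooth norm on the space of symmetric real $n\times n$ matrices. -/

import Mathlib

open scoped ENNReal

/- Matrices carry no global norm in Mathlib. The Frobenius norm serves only as the reference
norm of the finite-dimensional space of matrices, so that `ContDiff` and `fderiv` make sense;
in finite dimension neither depends on the choice of the reference norm. -/
attribute [local instance] Matrix.frobeniusNormedAddCommGroup Matrix.frobeniusNormedSpace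

namespace RegularSpaces

/-- `N` is a norm on the real vector space `E`. -/
structure IsNorm {E : Type*} [AddCommGroup E] [Module ℝ E] (N : E → ℝ) : Prop where
  add_le : ∀ x y : E, N (x + y) ≤ N x + N y
  smul_eq : ∀ (c : ℝ) (x : E), N (c • x) = |c| * N x
  eq_zero : ∀ x : E, N x = 0 → x = 0

/-- The norm `N` on the finite-dimensional space `E` is `κ`-smooth, where `κ ≥ 1`:
`p x = N x ^ 2` is continuously differentiable and `p (x + y) ≤ p x + Dp(x)[y] + κ * p y`.
The norm instance of `E` is only a reference norm for the derivative. -/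
structure IsSmoothNorm {E : Type*} [NormedAddCommGroup E] [NormedSpace ℝ E]
    [FiniteDimensional ℝ E] (κ : ℝ) (N : E → ℝ) : Prop where
  one_le : 1 ≤ κ
  isNorm : IsNorm N
  contDiff : ContDiff ℝ 1 (fun x : E => N x ^ 2)
  le : ∀ x y : E,
    N (x + y) ^ 2 ≤ N x ^ 2 + fderiv ℝ (fun z : E => N z ^ 2) x y + κ * N y ^ 2

/-- The norm `N` on the finite-dimensional space `E` is `κ`-regular, where `κ ≥ 1`: for some
`κ' ∈ [1, κ]` there is a `κ'`-smooth norm `N'` with `N ^ 2 ≤ N' ^ 2 ≤ (κ / κ') * N ^ 2`. -/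
structure IsRegularNorm {E : Type*} [NormedAddCommGroup E] [NormedSpace ℝ E]
    [FiniteDimensional ℝ E] (κ : ℝ) (N : E → ℝ) : Prop where
  one_le : 1 ≤ κ
  isNorm : IsNorm N
  exists_smooth : ∃ κ' : ℝ, 1 ≤ κ' ∧ κ' ≤ κ ∧ ∃ N' : E → ℝ, IsSmoothNorm κ' N' ∧
    ∀ x : E, N x ^ 2 ≤ N' x ^ 2 ∧ N' x ^ 2 ≤ κ / κ' * N x ^ 2

/-- The vector of the `min m n` singular values of a real `m × n` matrix, in decreasing order
and with multiplicity. -/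
noncomputable def singularVec {m n : ℕ} (X : Matrix (Fin m) (Fin n) ℝ) : Fin (min m n) → ℝ :=
  fun i => (Matrix.toEuclideanLin X).singularValues i

/-- The Schatten norm `|X|_p`: the `ℓ_p` norm of the vector of singular values. -/
noncomputable def schattenNorm (p : ℝ≥0∞) {m n : ℕ} (X : Matrix (Fin m) (Fin n) ℝ) : ℝ :=
  ‖WithLp.toLp p (singularVec X)‖

/-- The space of symmetric real `n × n` matrices. -/
def symMatrices (n : ℕ) : Submodule ℝ (Matrix (Fin n) (Fin n) ℝ) where
  carrier := {X | X.IsSymm}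
  add_mem' hX hY := Matrix.IsSymm.add hX hY
  zero_mem' := Matrix.isSymm_zero
  smul_mem' c _ hX := Matrix.IsSymm.smul hX c

/-- The numbers `max(2, ρ - 1) * min(m, n) ^ (2/ρ - 2/p)`, where `2 ≤ ρ < ∞` and `ρ ≤ p`. -/
def kappaSet (p : ℝ≥0∞) (m n : ℕ) : Set ℝ :=
  {k | ∃ ρ : ℝ, 2 ≤ ρ ∧ ENNReal.ofReal ρ ≤ p ∧
    k = max 2 (ρ - 1) * ((min m n : ℕ) : ℝ) ^ (2 / ρ - (2 / p).toReal)}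

/-- The constant `κ_p(m, n)`. -/
noncomputable def kappa (p : ℝ≥0∞) (m n : ℕ) : ℝ :=
  sInf (kappaSet p m n)

end RegularSpaces

/-! Smoothness rests on a first-order estimate for `tr |X| ^ ρ`, with no second derivative. In
eigenbases `u i` of `X` and `v j` of `Y`, trace expressions in `X` and `Y` become double sums over
pairs of eigenvalues, weighted by the doubly stochastic array `⟪u i, v j⟫ ^ 2`. Scalar inequalities
can then be applied term by term. The tangent inequality for `|t| ^ ρ` becomes Klein's inequality
(`traceRpow_add_le`). The trapezoidal bound for `|t| ^ (ρ - 2) * t`, which is where `max 2 (ρ - 1)`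
originates, becomes with Hölder's inequality a one-sided Lipschitz estimate for the derivative
(`traceDeriv_sub_le`).

`IsPowerPotential` isolates what these estimates provide. The tangent inequality gives convexity,
hence the triangle inequality, and differentiability. Along a line avoiding the origin, the
Lipschitz estimate bounds the growth of the derivative of `S ^ (2 / ρ)`: the powers of `S` cancel,
and the term coming from the concavity of `s ^ (2 / ρ)` has a favourable sign. Integration gives
`IsPowerPotential.isSmoothNorm`.

A rectangular matrix is replaced by its symmetric dilation, whose nonzero eigenvalues are plus and
minus the nonzero singular values. The Schatten `ρ`-norm is thus a constant times a norm already
known to be smooth. Restriction to symmetric matrices gives (b). For (a), the Schatten `p`-norm is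
compared with the `ρ`-norm at an optimal `ρ`; the choice `ρ = 2 ln(d + 2)`, where `d = min m n`,
gives the logarithmic bound because `d ^ (1 / ln(d + 2)) ≤ e`. -/

namespace RegularSpaces

/-! ### Scalar inequalities for powers, and Hölder's inequality with doubly stochastic weights. -/

section Scalar

lemma rpow_sub_two_mul_sq {t ρ : ℝ} (hρ : 2 ≤ ρ) : |t| ^ (ρ - 2) * t ^ 2 = |t| ^ ρ := by
  rw [← sq_abs, ← Real.rpow_natCast |t| 2, ← Real.rpow_add_of_nonneg (abs_nonneg t) (by linarith)
    (by norm_num)]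
  norm_num

lemma rpow_sub_two_mul_abs {t ρ : ℝ} (hρ : 2 ≤ ρ) : |t| ^ (ρ - 2) * |t| = |t| ^ (ρ - 1) := by
  nth_rewrite 2 [← Real.rpow_one |t|]
  rw [← Real.rpow_add_of_nonneg (abs_nonneg t) (by linarith) (by norm_num)]
  congr 1; ring

/-- The tangent inequality for the convex function `|t| ^ ρ`. -/
lemma abs_rpow_tangent_le {ρ : ℝ} (hρ : 2 ≤ ρ) (a b : ℝ) :
    |a| ^ ρ + ρ * ((|a| ^ (ρ - 2) * a) * (b - a)) ≤ |b| ^ ρ := by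
  have hc : (ρ / (ρ - 1)).HolderConjugate ρ := by
    rw [Real.holderConjugate_iff]
    constructor
    · rw [lt_div_iff₀] <;> linarith
    · field_simp; ring
  -- Young's inequality for `|a| ^ (ρ - 1) * |b|` is the tangent inequality once the term `|a| ^ ρ`
  -- is moved across.
  have hy := Real.young_inequality_of_nonneg (Real.rpow_nonneg (abs_nonneg a) (ρ - 1))
    (abs_nonneg b) hc
  rw [← Real.rpow_mul (abs_nonneg a), mul_div_cancel₀ _ (by linarith : ρ - 1 ≠ 0)] at hy
  have h1 : |a| ^ (ρ - 2) * a * b ≤ |a| ^ (ρ - 1) * |b| := by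
    rw [← rpow_sub_two_mul_abs hρ, mul_assoc, mul_assoc, ← abs_mul]
    exact mul_le_mul_of_nonneg_left (le_abs_self _) (by positivity)
  have h2 : |a| ^ (ρ - 2) * a * a = |a| ^ ρ := by
    rw [mul_assoc, ← sq, rpow_sub_two_mul_sq hρ]
  have h3 : |a| ^ ρ / (ρ / (ρ - 1)) = |a| ^ ρ - |a| ^ ρ / ρ := by
    field_simp
  rw [h3] at hy
  have h4 := mul_le_mul_of_nonneg_left (h1.trans hy) (by linarith : 0 ≤ ρ)
  have h5 : ρ * (|a| ^ ρ - |a| ^ ρ / ρ + |b| ^ ρ / ρ) = ρ * |a| ^ ρ - |a| ^ ρ + |b| ^ ρ := by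
    field_simp
  rw [h5] at h4
  calc _ = |a| ^ ρ + ρ * (|a| ^ (ρ - 2) * a * b) - ρ * (|a| ^ (ρ - 2) * a * a) := by ring
    _ ≤ _ := by rw [h2]; linarith

/-- The trapezoidal upper bound for the increment of a power. -/
lemma rpow_sub_rpow_le {s a b : ℝ} (hs : 2 ≤ s) (hb : 0 ≤ b) (hab : b ≤ a) :
    a ^ s - b ^ s ≤ s / 2 * (a ^ (s - 1) + b ^ (s - 1)) * (a - b) := by
  let φ : ℝ → ℝ := fun t => s / 2 * (t ^ (s - 1) + b ^ (s - 1)) * (t - b) - t ^ s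
  have hd : ∀ t, HasDerivAt φ (s / 2 * ((s - 1) * t ^ (s - 1 - 1)) * (t - b) +
      s / 2 * (t ^ (s - 1) + b ^ (s - 1)) * 1 - s * t ^ (s - 1)) t := fun t =>
    ((((Real.hasDerivAt_rpow_const (Or.inr (by linarith))).add_const _).const_mul _).mul
      ((hasDerivAt_id t).sub_const b)).sub (Real.hasDerivAt_rpow_const (Or.inr (by linarith)))
  have hm : MonotoneOn φ (Set.Ici b) := by
    apply monotoneOn_of_deriv_nonneg (convex_Ici b)
    · exact fun t _ => (hd t).continuousAt.continuousWithinAt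
    · exact fun t _ => (hd t).differentiableAt.differentiableWithinAt
    · intro t ht
      rw [interior_Ici, Set.mem_Ioi] at ht
      rw [(hd t).deriv]
      have ht0 : 0 < t := hb.trans_lt ht
      -- Bernoulli's inequality puts the tangent of `x ^ (s - 1)` at `t` below its value at `b`; up
      -- to the factor `s / 2` this says that `φ` has nonnegative derivative at `t`.
      have hB := one_add_mul_self_le_rpow_one_add (s := b / t - 1) (p := s - 1)
        (by have : 0 ≤ b / t := by positivity
            linarith) (by linarith)
      rw [add_sub_cancel, Real.div_rpow hb ht0.le, le_div_iff₀ (by positivity)] at hB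
      have hB' : (1 + (s - 1) * (b / t - 1)) * t ^ (s - 1)
          = t ^ (s - 1) + (s - 1) * t ^ (s - 1 - 1) * (b - t) := by
        rw [Real.rpow_sub_one ht0.ne' (s - 1)]
        field_simp
      rw [hB'] at hB
      have := mul_le_mul_of_nonneg_left hB (by linarith : 0 ≤ s / 2)
      linarith
  have := hm (Set.self_mem_Ici) (Set.mem_Ici.2 hab) hab
  simp only [φ] at this
  linarith

/-- For `ρ ≤ 3` the constant is 1, and expanding the product leaves `a ^ (ρ - 2) * b ≤ b ^ (ρ - 2) *
a`, true because `t ^ (ρ - 3)` is nonincreasing. For `ρ ≥ 3` it is the trapezoidal bound with `s = ρ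
- 1`. -/
lemma rpow_mul_sub_rpow_mul_le {ρ a b : ℝ} (hρ : 2 ≤ ρ) (hb : 0 ≤ b) (hab : b ≤ a) :
    a ^ (ρ - 2) * a - b ^ (ρ - 2) * b ≤
      max 2 (ρ - 1) / 2 * (a ^ (ρ - 2) + b ^ (ρ - 2)) * (a - b) := by
  have ha : 0 ≤ a := hb.trans hab
  rcases le_total (ρ - 1) 2 with h | h
  · rw [max_eq_left h]
    have : a ^ (ρ - 2) * b ≤ b ^ (ρ - 2) * a := by
      rcases hb.eq_or_lt with rfl | hb0
      · simp only [mul_zero]; positivity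
      · have ha0 := hb0.trans_le hab
        have h1 : a ^ (ρ - 2) = a ^ (ρ - 3) * a := by
          rw [← Real.rpow_add_one ha0.ne']; congr 1; ring
        have h2 : b ^ (ρ - 2) = b ^ (ρ - 3) * b := by
          rw [← Real.rpow_add_one hb0.ne']; congr 1; ring
        have h3 : a ^ (ρ - 3) ≤ b ^ (ρ - 3) :=
          Real.rpow_le_rpow_of_nonpos hb0 hab (by linarith)
        rw [h1, h2, mul_assoc, mul_assoc, mul_comm b a]
        exact mul_le_mul_of_nonneg_right h3 (by positivity)
    linarith
  · rw [max_eq_right h]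
    have key := rpow_sub_rpow_le h hb hab
    have e : ∀ t : ℝ, 0 ≤ t → t ^ (ρ - 2) * t = t ^ (ρ - 1) := fun t ht => by
      simpa [abs_of_nonneg ht] using rpow_sub_two_mul_abs (t := t) hρ
    rw [e a ha, e b hb]
    rwa [show ρ - 1 - 1 = ρ - 2 by ring] at key

/-- A Lipschitz type bound for `|t| ^ (ρ - 2) * t`. -/
lemma abs_rpow_mul_sub_le {ρ : ℝ} (hρ : 2 ≤ ρ) (a b : ℝ) :
    |(|a| ^ (ρ - 2) * a) - (|b| ^ (ρ - 2) * b)| ≤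
      max 2 (ρ - 1) / 2 * (|a| ^ (ρ - 2) + |b| ^ (ρ - 2)) * |a - b| := by
  -- For opposite signs the two terms add up, and a constant at least 1 suffices: expanding the
  -- product only produces further nonnegative cross terms.
  have opp : ∀ a b : ℝ, 0 ≤ a → 0 ≤ b → |(|a| ^ (ρ - 2) * a) - (|-b| ^ (ρ - 2) * -b)| ≤
      max 2 (ρ - 1) / 2 * (|a| ^ (ρ - 2) + |-b| ^ (ρ - 2)) * |a - -b| := by
    intro a b ha hb
    rw [abs_neg, abs_of_nonneg ha, abs_of_nonneg hb, sub_neg_eq_add, abs_of_nonneg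
      (by positivity : 0 ≤ a + b), mul_neg, sub_neg_eq_add, abs_of_nonneg (by positivity)]
    have h2 : 1 ≤ max 2 (ρ - 1) / 2 := by
      have := le_max_left 2 (ρ - 1)
      linarith
    have h3 : 0 ≤ (a ^ (ρ - 2) + b ^ (ρ - 2)) * (a + b) := by positivity
    have h4 : 0 ≤ a ^ (ρ - 2) * b + b ^ (ρ - 2) * a := by positivity
    nlinarith
  have same : ∀ a b : ℝ, 0 ≤ b → b ≤ a → |(|a| ^ (ρ - 2) * a) - (|b| ^ (ρ - 2) * b)| ≤
      max 2 (ρ - 1) / 2 * (|a| ^ (ρ - 2) + |b| ^ (ρ - 2)) * |a - b| := by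
    intro a b hb hab
    have ha := hb.trans hab
    rw [abs_of_nonneg ha, abs_of_nonneg hb, abs_of_nonneg (sub_nonneg.2 hab), abs_of_nonneg]
    · exact rpow_mul_sub_rpow_mul_le hρ hb hab
    · rw [sub_nonneg]
      gcongr
  have same' : ∀ a b : ℝ, 0 ≤ a → 0 ≤ b → |(|a| ^ (ρ - 2) * a) - (|b| ^ (ρ - 2) * b)| ≤
      max 2 (ρ - 1) / 2 * (|a| ^ (ρ - 2) + |b| ^ (ρ - 2)) * |a - b| := by
    intro a b ha hb
    rcases le_total b a with h | h
    · exact same a b hb h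
    · rw [abs_sub_comm, abs_sub_comm a b, add_comm (|a| ^ (ρ - 2))]
      exact same b a ha h
  rcases le_total 0 a with ha | ha <;> rcases le_total 0 b with hb | hb
  · exact same' a b ha hb
  · simpa using opp a (-b) ha (by linarith)
  · have := opp b (-a) hb (by linarith)
    rw [neg_neg] at this
    rwa [abs_sub_comm, abs_sub_comm a b, add_comm (|a| ^ (ρ - 2))]
  · have := same' (-a) (-b) (by linarith) (by linarith)
    rw [abs_neg, abs_neg, mul_neg, mul_neg, ← neg_sub_neg, neg_neg, neg_neg, ← neg_sub', abs_neg]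
      at this
    rwa [abs_sub_comm]

lemma rpow_mul_sub_mul_sub_le {ρ : ℝ} (hρ : 2 ≤ ρ) (a b : ℝ) :
    ((|a| ^ (ρ - 2) * a) - (|b| ^ (ρ - 2) * b)) * (a - b) ≤
      max 2 (ρ - 1) / 2 * (|a| ^ (ρ - 2) + |b| ^ (ρ - 2)) * (a - b) ^ 2 := by
  refine (le_abs_self _).trans ?_
  rw [abs_mul, ← sq_abs (a - b), sq, ← mul_assoc]
  exact mul_le_mul_of_nonneg_right (abs_rpow_mul_sub_le hρ a b) (abs_nonneg _)

/-- Hölder's inequality with a doubly stochastic weight. -/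
lemma sum_rpow_mul_sq_le {ι κ : Type*} [Fintype ι] [Fintype κ] {ρ : ℝ} (hρ : 2 ≤ ρ)
    (a : ι → ℝ) (h : κ → ℝ) (d : ι → κ → ℝ) (hd : ∀ i k, 0 ≤ d i k)
    (hr : ∀ i, ∑ k, d i k = 1) (hc : ∀ k, ∑ i, d i k = 1) :
    ∑ i, ∑ k, |a i| ^ (ρ - 2) * (h k ^ 2 * d i k) ≤
      (∑ i, |a i| ^ ρ) ^ ((ρ - 2) / ρ) * (∑ k, |h k| ^ ρ) ^ (2 / ρ) := by
  have ea : ∑ x : ι × κ, |a x.1| ^ ρ * d x.1 x.2 = ∑ i, |a i| ^ ρ := by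
    rw [Fintype.sum_prod_type]
    simp only [← Finset.mul_sum, hr, mul_one]
  have eh : ∑ x : ι × κ, |h x.2| ^ ρ * d x.1 x.2 = ∑ k, |h k| ^ ρ := by
    rw [Fintype.sum_prod_type_right]
    simp only [← Finset.mul_sum, hc, mul_one]
  rw [← ea, ← eh, ← Fintype.sum_prod_type']
  -- At `ρ = 2` the conjugate exponent `ρ / (ρ - 2)` degenerates, so this case is separate.
  rcases hρ.eq_or_lt with rfl | hρ'
  · norm_num
  have hρ0 : 0 < ρ := by linarith
  have hρ2 : 0 < ρ - 2 := by linarith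
  have hpq : (ρ / (ρ - 2)).HolderConjugate (ρ / 2) := by
    rw [Real.holderConjugate_iff]
    constructor
    · rw [lt_div_iff₀] <;> linarith
    · field_simp; ring
  have key := Real.inner_le_Lp_mul_Lq_of_nonneg (s := (Finset.univ : Finset (ι × κ))) hpq
    (f := fun x => |a x.1| ^ (ρ - 2) * d x.1 x.2 ^ ((ρ - 2) / ρ))
    (g := fun x => |h x.2| ^ (2 : ℝ) * d x.1 x.2 ^ (2 / ρ))
    (fun x _ => by have := hd x.1 x.2; positivity) (fun x _ => by have := hd x.1 x.2; positivity)
  have e1 : ∀ x : ι × κ, (|a x.1| ^ (ρ - 2) * d x.1 x.2 ^ ((ρ - 2) / ρ)) ^ (ρ / (ρ - 2))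
      = |a x.1| ^ ρ * d x.1 x.2 := fun x => by
    have := hd x.1 x.2
    rw [Real.mul_rpow (by positivity) (by positivity), ← Real.rpow_mul (abs_nonneg _),
      ← Real.rpow_mul this, mul_div_cancel₀ _ hρ2.ne']
    rw [show (ρ - 2) / ρ * (ρ / (ρ - 2)) = 1 by field_simp, Real.rpow_one]
  have e2 : ∀ x : ι × κ, (|h x.2| ^ (2 : ℝ) * d x.1 x.2 ^ (2 / ρ)) ^ (ρ / 2)
      = |h x.2| ^ ρ * d x.1 x.2 := fun x => by
    have := hd x.1 x.2
    rw [Real.mul_rpow (by positivity) (by positivity), ← Real.rpow_mul (abs_nonneg _),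
      ← Real.rpow_mul this]
    rw [show 2 / ρ * (ρ / 2) = 1 by field_simp, Real.rpow_one, show 2 * (ρ / 2) = ρ by ring]
  simp only [e1, e2, one_div_div] at key
  refine le_trans (le_of_eq (Finset.sum_congr rfl fun x _ => ?_)) key
  have h1 : d x.1 x.2 = d x.1 x.2 ^ ((ρ - 2) / ρ) * d x.1 x.2 ^ (2 / ρ) := by
    rw [← Real.rpow_add_of_nonneg (hd _ _) (by positivity) (by positivity)]
    rw [show (ρ - 2) / ρ + 2 / ρ = 1 by field_simp; ring, Real.rpow_one]
  have h2 : |h x.2| ^ (2 : ℝ) = h x.2 ^ 2 := by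
    rw [Real.rpow_two, sq_abs]
  rw [h2]
  nth_rewrite 1 [h1]
  ring

end Scalar

/-! ### Trace functions of symmetric operators through pairs of eigenbases. -/

section Spectral

open scoped RealInnerProductSpace

variable {E : Type*} [NormedAddCommGroup E] [InnerProductSpace ℝ E]
  {ι κ : Type*} [Fintype ι] [Fintype κ]

/-- The bridge from differences of eigenvalues to the operator difference. Taking `Y = X` also gives
orthogonality of eigenvectors with distinct eigenvalues. -/
lemma inner_sub_apply {X Y : E →ₗ[ℝ] E} (hY : Y.IsSymmetric) {u v : E} {a b : ℝ}
    (hu : X u = a • u) (hv : Y v = b • v) : ⟪v, (Y - X) u⟫ = (b - a) * ⟪v, u⟫ := by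
  rw [LinearMap.sub_apply, inner_sub_right, ← hY v u, hu, hv, real_inner_smul_left,
    real_inner_smul_right]
  ring

/-- Sums over the spectrum do not depend on the diagonalizing basis. -/
lemma sum_eigenvalues_congr (u : OrthonormalBasis ι ℝ E) (v : OrthonormalBasis κ ℝ E)
    (f : ι → ℝ) (g : κ → ℝ) (h : ∀ i k, ⟪u i, v k⟫ ≠ 0 → f i = g k) :
    ∑ i, f i = ∑ k, g k := by
  have h1 : ∀ i, f i = ∑ k, f i * ⟪u i, v k⟫ ^ 2 := fun i => by
    rw [← Finset.mul_sum, v.sum_sq_inner_left, u.norm_eq_one]; simp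
  have h2 : ∀ k, g k = ∑ i, g k * ⟪u i, v k⟫ ^ 2 := fun k => by
    rw [← Finset.mul_sum, u.sum_sq_inner_right, v.norm_eq_one]; simp
  rw [Finset.sum_congr rfl fun i _ => h1 i, Finset.sum_congr rfl fun k _ => h2 k,
    Finset.sum_comm]
  refine Finset.sum_congr rfl fun k _ => Finset.sum_congr rfl fun i _ => ?_
  by_cases hz : ⟪u i, v k⟫ = 0
  · simp [hz]
  · rw [h i k hz]

lemma inner_apply_self_eq_sum {Y : E →ₗ[ℝ] E} (hY : Y.IsSymmetric) (v : OrthonormalBasis κ ℝ E)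
    {b : κ → ℝ} (hv : ∀ k, Y (v k) = b k • v k) (w : E) :
    ⟪w, Y w⟫ = ∑ k, b k * ⟪w, v k⟫ ^ 2 := by
  rw [← v.sum_inner_mul_inner]
  refine Finset.sum_congr rfl fun k _ => ?_
  rw [← hY, hv, real_inner_smul_left, real_inner_comm w]
  ring

lemma norm_apply_sq_eq_sum {Y : E →ₗ[ℝ] E} (hY : Y.IsSymmetric) (v : OrthonormalBasis κ ℝ E)
    {b : κ → ℝ} (hv : ∀ k, Y (v k) = b k • v k) (w : E) :
    ‖Y w‖ ^ 2 = ∑ k, b k ^ 2 * ⟪w, v k⟫ ^ 2 := by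
  rw [← v.sum_sq_inner_right]
  refine Finset.sum_congr rfl fun k _ => ?_
  rw [← hY, hv, real_inner_smul_left, real_inner_comm w]
  ring

variable [FiniteDimensional ℝ E]

/-- `tr |T| ^ ρ` for a symmetric operator `T`. -/
noncomputable def traceRpow (ρ : ℝ) {T : E →ₗ[ℝ] E} (hT : T.IsSymmetric) : ℝ :=
  ∑ i, |hT.eigenvalues rfl i| ^ ρ

/-- `tr (|T| ^ (ρ - 2) T H)` for a symmetric operator `T`. -/
noncomputable def traceDeriv (ρ : ℝ) {T : E →ₗ[ℝ] E} (hT : T.IsSymmetric) :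
    (E →ₗ[ℝ] E) →ₗ[ℝ] ℝ where
  toFun H := ∑ i, |hT.eigenvalues rfl i| ^ (ρ - 2) * hT.eigenvalues rfl i *
    ⟪hT.eigenvectorBasis rfl i, H (hT.eigenvectorBasis rfl i)⟫
  map_add' H K := by
    simp only [LinearMap.add_apply, inner_add_right, mul_add, Finset.sum_add_distrib]
  map_smul' c H := by
    simp only [LinearMap.smul_apply, real_inner_smul_right, RingHom.id_apply, smul_eq_mul,
      Finset.mul_sum]
    exact Finset.sum_congr rfl fun i _ => by ring

lemma traceDeriv_apply (ρ : ℝ) {T : E →ₗ[ℝ] E} (hT : T.IsSymmetric) (H : E →ₗ[ℝ] E) :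
    traceDeriv ρ hT H = ∑ i, |hT.eigenvalues rfl i| ^ (ρ - 2) * hT.eigenvalues rfl i *
      ⟪hT.eigenvectorBasis rfl i, H (hT.eigenvectorBasis rfl i)⟫ := rfl

lemma apply_eigenvectorBasis' {T : E →ₗ[ℝ] E} (hT : T.IsSymmetric)
    (i : Fin (Module.finrank ℝ E)) :
    T (hT.eigenvectorBasis rfl i) = hT.eigenvalues rfl i • hT.eigenvectorBasis rfl i :=
  hT.apply_eigenvectorBasis rfl i

lemma traceRpow_nonneg (ρ : ℝ) {T : E →ₗ[ℝ] E} (hT : T.IsSymmetric) : 0 ≤ traceRpow ρ hT :=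
  Finset.sum_nonneg fun _ _ => by positivity

lemma traceRpow_eq_sum {ρ : ℝ} {T : E →ₗ[ℝ] E} (hT : T.IsSymmetric)
    (v : OrthonormalBasis κ ℝ E) {b : κ → ℝ} (hv : ∀ k, T (v k) = b k • v k) :
    traceRpow ρ hT = ∑ k, |b k| ^ ρ := by
  refine sum_eigenvalues_congr (hT.eigenvectorBasis rfl) v _ _ fun i k h => ?_
  have := inner_sub_apply hT (hv k) (apply_eigenvectorBasis' hT i)
  rw [sub_self, LinearMap.zero_apply, inner_zero_right, eq_comm, mul_eq_zero] at this
  rw [sub_eq_zero.1 (this.resolve_right h)]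

lemma traceRpow_smul {ρ : ℝ} {T : E →ₗ[ℝ] E} (hT : T.IsSymmetric) (c : ℝ)
    (hcT : (c • T).IsSymmetric) : traceRpow ρ hcT = |c| ^ ρ * traceRpow ρ hT := by
  rw [traceRpow_eq_sum hcT (hT.eigenvectorBasis rfl) (b := fun i => c * hT.eigenvalues rfl i)]
  · simp only [abs_mul, Real.mul_rpow (abs_nonneg _) (abs_nonneg _), traceRpow, Finset.mul_sum]
  · intro k
    rw [LinearMap.smul_apply, apply_eigenvectorBasis', smul_smul]

lemma traceRpow_eq_zero_iff {ρ : ℝ} (hρ : 0 < ρ) {T : E →ₗ[ℝ] E} (hT : T.IsSymmetric) :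
    traceRpow ρ hT = 0 ↔ T = 0 := by
  constructor
  · intro h
    rw [traceRpow, Finset.sum_eq_zero_iff_of_nonneg fun _ _ => by positivity] at h
    refine (hT.eigenvectorBasis rfl).toBasis.ext fun i => ?_
    have := h i (Finset.mem_univ _)
    rw [Real.rpow_eq_zero (abs_nonneg _) hρ.ne', abs_eq_zero] at this
    simp [this]
  · rintro rfl
    rw [traceRpow_eq_sum hT (stdOrthonormalBasis ℝ E) (b := 0) (by simp)]
    simp [hρ.ne']

lemma traceDeriv_self {ρ : ℝ} (hρ : 2 ≤ ρ) {T : E →ₗ[ℝ] E} (hT : T.IsSymmetric) :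
    traceDeriv ρ hT T = traceRpow ρ hT := by
  rw [traceDeriv_apply]
  refine Finset.sum_congr rfl fun i _ => ?_
  rw [apply_eigenvectorBasis', real_inner_smul_right, real_inner_self_eq_norm_sq,
    OrthonormalBasis.norm_eq_one, ← rpow_sub_two_mul_sq hρ]
  ring

lemma traceDeriv_eq_sum {ρ : ℝ} {X Y : E →ₗ[ℝ] E} (hX : X.IsSymmetric) (hY : Y.IsSymmetric) :
    traceDeriv ρ hX Y = ∑ i, ∑ j, |hX.eigenvalues rfl i| ^ (ρ - 2) * hX.eigenvalues rfl i *
      (hY.eigenvalues rfl j * ⟪hX.eigenvectorBasis rfl i, hY.eigenvectorBasis rfl j⟫ ^ 2) := by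
  rw [traceDeriv_apply]
  refine Finset.sum_congr rfl fun i _ => ?_
  rw [inner_apply_self_eq_sum hY _ (apply_eigenvectorBasis' hY), Finset.mul_sum]

lemma traceRpow_eq_sum_left {ρ : ℝ} {X Y : E →ₗ[ℝ] E} (hX : X.IsSymmetric) (hY : Y.IsSymmetric) :
    traceRpow ρ hX = ∑ i, ∑ j, |hX.eigenvalues rfl i| ^ ρ *
      ⟪hX.eigenvectorBasis rfl i, hY.eigenvectorBasis rfl j⟫ ^ 2 := by
  refine Finset.sum_congr rfl fun i _ => ?_
  rw [← Finset.mul_sum, OrthonormalBasis.sum_sq_inner_left, OrthonormalBasis.norm_eq_one]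
  simp

lemma traceRpow_eq_sum_right {ρ : ℝ} {X Y : E →ₗ[ℝ] E} (hX : X.IsSymmetric)
    (hY : Y.IsSymmetric) :
    traceRpow ρ hY = ∑ i, ∑ j, |hY.eigenvalues rfl j| ^ ρ *
      ⟪hX.eigenvectorBasis rfl i, hY.eigenvectorBasis rfl j⟫ ^ 2 := by
  rw [Finset.sum_comm]
  refine Finset.sum_congr rfl fun i _ => ?_
  rw [← Finset.mul_sum, OrthonormalBasis.sum_sq_inner_right, OrthonormalBasis.norm_eq_one]
  simp

/-- Klein's inequality for `tr |X| ^ ρ`. -/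
lemma traceRpow_add_le {ρ : ℝ} (hρ : 2 ≤ ρ) {X Y : E →ₗ[ℝ] E} (hX : X.IsSymmetric)
    (hY : Y.IsSymmetric) :
    traceRpow ρ hX + ρ * traceDeriv ρ hX (Y - X) ≤ traceRpow ρ hY := by
  rw [map_sub, traceDeriv_self hρ, traceRpow_eq_sum_left hX hY, traceRpow_eq_sum_right hX hY,
    traceDeriv_eq_sum hX hY, ← Finset.sum_sub_distrib, Finset.mul_sum, ← Finset.sum_add_distrib]
  refine Finset.sum_le_sum fun i _ => ?_
  rw [← Finset.sum_sub_distrib, Finset.mul_sum, ← Finset.sum_add_distrib]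
  refine Finset.sum_le_sum fun j _ => ?_
  have h := mul_le_mul_of_nonneg_right
    (abs_rpow_tangent_le hρ (hX.eigenvalues rfl i) (hY.eigenvalues rfl j))
    (sq_nonneg ⟪hX.eigenvectorBasis rfl i, hY.eigenvectorBasis rfl j⟫)
  refine le_trans (le_of_eq ?_) h
  rw [← rpow_sub_two_mul_sq (t := hX.eigenvalues rfl i) hρ]
  ring

lemma sum_rpow_mul_norm_sq_le {ρ : ℝ} (hρ : 2 ≤ ρ) {X H : E →ₗ[ℝ] E} (hX : X.IsSymmetric)
    (hH : H.IsSymmetric) :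
    ∑ i, |hX.eigenvalues rfl i| ^ (ρ - 2) * ‖H (hX.eigenvectorBasis rfl i)‖ ^ 2 ≤
      traceRpow ρ hX ^ ((ρ - 2) / ρ) * traceRpow ρ hH ^ (2 / ρ) := by
  refine le_trans (le_of_eq ?_) (sum_rpow_mul_sq_le hρ (hX.eigenvalues rfl) (hH.eigenvalues rfl)
    (fun i k => ⟪hX.eigenvectorBasis rfl i, hH.eigenvectorBasis rfl k⟫ ^ 2)
    (fun _ _ => sq_nonneg _) (fun i => ?_) (fun k => ?_))
  · refine Finset.sum_congr rfl fun i _ => ?_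
    rw [norm_apply_sq_eq_sum hH _ (apply_eigenvectorBasis' hH), Finset.mul_sum]
  · rw [OrthonormalBasis.sum_sq_inner_left, OrthonormalBasis.norm_eq_one, one_pow]
  · rw [OrthonormalBasis.sum_sq_inner_right, OrthonormalBasis.norm_eq_one, one_pow]

/-- Each squared eigenvalue difference times squared overlap is the square of a matrix entry of `Y -
X` between the two eigenbases, so Parseval's identity sums over `j`. -/
lemma sum_mul_sq_inner_eq {X Y : E →ₗ[ℝ] E} (hX : X.IsSymmetric) (hY : Y.IsSymmetric)
    (f : ℝ → ℝ) :
    ∑ i, ∑ j, f (hX.eigenvalues rfl i) * ((hY.eigenvalues rfl j - hX.eigenvalues rfl i) ^ 2 *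
      ⟪hX.eigenvectorBasis rfl i, hY.eigenvectorBasis rfl j⟫ ^ 2) =
    ∑ i, f (hX.eigenvalues rfl i) * ‖(Y - X) (hX.eigenvectorBasis rfl i)‖ ^ 2 := by
  refine Finset.sum_congr rfl fun i _ => ?_
  rw [← (hY.eigenvectorBasis rfl).sum_sq_inner_right, Finset.mul_sum]
  refine Finset.sum_congr rfl fun j _ => ?_
  rw [inner_sub_apply hY (apply_eigenvectorBasis' hX i) (apply_eigenvectorBasis' hY j), mul_pow,
    real_inner_comm]

/-- One-sided Lipschitz estimate for the derivative of `tr |X| ^ ρ`. -/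
lemma traceDeriv_sub_le {ρ : ℝ} (hρ : 2 ≤ ρ) {X Y : E →ₗ[ℝ] E} (hX : X.IsSymmetric)
    (hY : Y.IsSymmetric) (hYX : (Y - X).IsSymmetric) :
    traceDeriv ρ hY (Y - X) - traceDeriv ρ hX (Y - X) ≤
      max 2 (ρ - 1) / 2 * ((traceRpow ρ hX ^ ((ρ - 2) / ρ) + traceRpow ρ hY ^ ((ρ - 2) / ρ)) *
        traceRpow ρ hYX ^ (2 / ρ)) := by
  have hXY : (X - Y).IsSymmetric := hX.sub hY
  have e0 : traceRpow ρ hXY = traceRpow ρ hYX := by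
    have : X - Y = (-1 : ℝ) • (Y - X) := by simp
    have h2 := traceRpow_smul (ρ := ρ) hYX (-1) (this ▸ hXY)
    simp only [abs_neg, abs_one, Real.one_rpow, one_mul] at h2
    rw [← h2]
    congr 1
  -- The noncommutative expression becomes a weighted sum of scalar products, to which
  -- `rpow_mul_sub_mul_sub_le` applies termwise.
  have e1 : traceDeriv ρ hY (Y - X) - traceDeriv ρ hX (Y - X) =
      ∑ i, ∑ j, ((|hX.eigenvalues rfl i| ^ (ρ - 2) * hX.eigenvalues rfl i) -
        (|hY.eigenvalues rfl j| ^ (ρ - 2) * hY.eigenvalues rfl j)) *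
        (hX.eigenvalues rfl i - hY.eigenvalues rfl j) *
        ⟪hX.eigenvectorBasis rfl i, hY.eigenvectorBasis rfl j⟫ ^ 2 := by
    rw [map_sub, map_sub, traceDeriv_self hρ, traceDeriv_self hρ, traceRpow_eq_sum_left hX hY,
      traceRpow_eq_sum_right hX hY, traceDeriv_eq_sum hX hY, traceDeriv_eq_sum hY hX]
    rw [Finset.sum_comm (f := fun j i => |hY.eigenvalues rfl j| ^ (ρ - 2) *
      hY.eigenvalues rfl j * (hX.eigenvalues rfl i *
        ⟪hY.eigenvectorBasis rfl j, hX.eigenvectorBasis rfl i⟫ ^ 2))]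
    simp only [← Finset.sum_sub_distrib]
    refine Finset.sum_congr rfl fun i _ => Finset.sum_congr rfl fun j _ => ?_
    rw [← rpow_sub_two_mul_sq (t := hX.eigenvalues rfl i) hρ,
      ← rpow_sub_two_mul_sq (t := hY.eigenvalues rfl j) hρ,
      real_inner_comm (hX.eigenvectorBasis rfl i)]
    ring
  have e2 : traceDeriv ρ hY (Y - X) - traceDeriv ρ hX (Y - X) ≤ max 2 (ρ - 1) / 2 *
      (∑ i, |hX.eigenvalues rfl i| ^ (ρ - 2) * ‖(Y - X) (hX.eigenvectorBasis rfl i)‖ ^ 2 +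
        ∑ j, |hY.eigenvalues rfl j| ^ (ρ - 2) * ‖(X - Y) (hY.eigenvectorBasis rfl j)‖ ^ 2) := by
    rw [e1, ← sum_mul_sq_inner_eq hX hY (fun t => |t| ^ (ρ - 2)),
      ← sum_mul_sq_inner_eq hY hX (fun t => |t| ^ (ρ - 2)), Finset.sum_comm (f := fun j i =>
        |hY.eigenvalues rfl j| ^ (ρ - 2) * ((hX.eigenvalues rfl i - hY.eigenvalues rfl j) ^ 2 *
        ⟪hY.eigenvectorBasis rfl j, hX.eigenvectorBasis rfl i⟫ ^ 2))]
    simp only [← Finset.sum_add_distrib, Finset.mul_sum]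
    refine Finset.sum_le_sum fun i _ => Finset.sum_le_sum fun j _ => ?_
    refine (mul_le_mul_of_nonneg_right (rpow_mul_sub_mul_sub_le hρ (hX.eigenvalues rfl i)
      (hY.eigenvalues rfl j)) (sq_nonneg _)).trans (le_of_eq ?_)
    rw [real_inner_comm (hX.eigenvectorBasis rfl i)]
    ring
  refine e2.trans ?_
  rw [add_mul]
  have : (0 : ℝ) ≤ max 2 (ρ - 1) := by positivity
  gcongr
  · exact sum_rpow_mul_norm_sq_le hρ hX hYX
  · rw [← e0]
    exact sum_rpow_mul_norm_sq_le hρ hY hXY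

lemma abs_eigenvalues_le {T : E →ₗ[ℝ] E} (hT : T.IsSymmetric) (i : Fin (Module.finrank ℝ E)) :
    |hT.eigenvalues rfl i| ≤ ‖T.toContinuousLinearMap‖ := by
  have h := T.toContinuousLinearMap.le_opNorm (hT.eigenvectorBasis rfl i)
  rw [LinearMap.coe_toContinuousLinearMap', apply_eigenvectorBasis', norm_smul,
    OrthonormalBasis.norm_eq_one, mul_one, mul_one] at h
  exact h

/-- Quantitative continuity of the derivative of `tr |X| ^ ρ`. -/
lemma abs_traceDeriv_sub_le {ρ : ℝ} (hρ : 2 ≤ ρ) {X Y : E →ₗ[ℝ] E} (hX : X.IsSymmetric)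
    (hY : Y.IsSymmetric) (H : E →ₗ[ℝ] E) :
    |traceDeriv ρ hY H - traceDeriv ρ hX H| ≤
      Module.finrank ℝ E * (Module.finrank ℝ E * (max 2 (ρ - 1) / 2 *
        (‖X.toContinuousLinearMap‖ ^ (ρ - 2) + ‖Y.toContinuousLinearMap‖ ^ (ρ - 2)) *
        ‖(Y - X).toContinuousLinearMap‖ * ‖H.toContinuousLinearMap‖)) := by
  set u := hX.eigenvectorBasis rfl with hu
  set v := hY.eigenvectorBasis rfl with hv
  -- Inserting the other eigenbasis writes both derivatives with the same kernel `⟪v j, H (u i)⟫ *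
  -- ⟪u i, v j⟫`, so their difference involves only scalar differences.
  have e1 : traceDeriv ρ hY H = ∑ i, ∑ j, |hY.eigenvalues rfl j| ^ (ρ - 2) *
      hY.eigenvalues rfl j * (⟪v j, H (u i)⟫ * ⟪u i, v j⟫) := by
    rw [Finset.sum_comm, traceDeriv_apply]
    refine Finset.sum_congr rfl fun j _ => ?_
    simp only [← Finset.mul_sum, ← LinearMap.adjoint_inner_left]
    rw [u.sum_inner_mul_inner]
  have e2 : traceDeriv ρ hX H = ∑ i, ∑ j, |hX.eigenvalues rfl i| ^ (ρ - 2) *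
      hX.eigenvalues rfl i * (⟪v j, H (u i)⟫ * ⟪u i, v j⟫) := by
    rw [traceDeriv_apply]
    refine Finset.sum_congr rfl fun i _ => ?_
    rw [← Finset.mul_sum, ← v.sum_inner_mul_inner]
    simp only [mul_comm, hu]
  have bound : ∀ i j, |(|hY.eigenvalues rfl j| ^ (ρ - 2) * hY.eigenvalues rfl j -
      |hX.eigenvalues rfl i| ^ (ρ - 2) * hX.eigenvalues rfl i) *
      (⟪v j, H (u i)⟫ * ⟪u i, v j⟫)| ≤ max 2 (ρ - 1) / 2 *
        (‖X.toContinuousLinearMap‖ ^ (ρ - 2) + ‖Y.toContinuousLinearMap‖ ^ (ρ - 2)) *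
        ‖(Y - X).toContinuousLinearMap‖ * ‖H.toContinuousLinearMap‖ := by
    intro i j
    have hρ2 : 0 ≤ ρ - 2 := by linarith
    have h0 : (0 : ℝ) ≤ max 2 (ρ - 1) := by positivity
    have h1 := abs_rpow_mul_sub_le hρ (hY.eigenvalues rfl j) (hX.eigenvalues rfl i)
    have h2 : |⟪v j, H (u i)⟫| ≤ ‖H.toContinuousLinearMap‖ := by
      refine (abs_real_inner_le_norm _ _).trans ?_
      simpa [OrthonormalBasis.norm_eq_one] using H.toContinuousLinearMap.le_opNorm (u i)
    -- The overlap absorbs the eigenvalue difference, so continuity of individual eigenvalues or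
    -- eigenvectors is not needed.
    have h3 : |hY.eigenvalues rfl j - hX.eigenvalues rfl i| * |⟪u i, v j⟫| ≤
        ‖(Y - X).toContinuousLinearMap‖ := by
      rw [← abs_mul, real_inner_comm, ← inner_sub_apply hY (apply_eigenvectorBasis' hX i)
        (apply_eigenvectorBasis' hY j)]
      refine (abs_real_inner_le_norm _ _).trans ?_
      simpa [OrthonormalBasis.norm_eq_one] using
        (Y - X).toContinuousLinearMap.le_opNorm (hX.eigenvectorBasis rfl i)
    rw [abs_mul, abs_mul]
    calc _ ≤ (max 2 (ρ - 1) / 2 * (|hY.eigenvalues rfl j| ^ (ρ - 2) +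
            |hX.eigenvalues rfl i| ^ (ρ - 2)) * |hY.eigenvalues rfl j - hX.eigenvalues rfl i|) *
          (|⟪v j, H (u i)⟫| * |⟪u i, v j⟫|) := by gcongr
      _ = max 2 (ρ - 1) / 2 * (|hX.eigenvalues rfl i| ^ (ρ - 2) +
            |hY.eigenvalues rfl j| ^ (ρ - 2)) *
          (|hY.eigenvalues rfl j - hX.eigenvalues rfl i| * |⟪u i, v j⟫|) *
          |⟪v j, H (u i)⟫| := by ring
      _ ≤ _ := by
        gcongr
        · exact abs_eigenvalues_le hX i
        · exact abs_eigenvalues_le hY j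
  rw [e1, e2, ← Finset.sum_sub_distrib]
  simp only [← Finset.sum_sub_distrib, ← sub_mul]
  refine (Finset.abs_sum_le_sum_abs _ _).trans ?_
  refine (Finset.sum_le_card_nsmul _ _ _ fun i _ => (Finset.abs_sum_le_sum_abs _ _).trans
    (Finset.sum_le_card_nsmul _ _ _ fun j _ => bound i j)).trans (le_of_eq ?_)
  simp only [Finset.card_univ, Fintype.card_fin, nsmul_eq_mul]

end Spectral

/-! ### From a power potential to a smooth norm. -/

section Potential

open Filter Topology Asymptotics

/-- `S` is the `ρ`-th power of a norm and `ρ • D` is its derivative, which satisfies a one-sided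
Lipschitz estimate with constant `κ`. -/
structure IsPowerPotential {V : Type*} [NormedAddCommGroup V] [NormedSpace ℝ V] (ρ κ : ℝ)
    (S : V → ℝ) (D : V → V →L[ℝ] ℝ) : Prop where
  nonneg : ∀ x, 0 ≤ S x
  eq_zero : ∀ x, S x = 0 → x = 0
  smul : ∀ (c : ℝ) x, S (c • x) = |c| ^ ρ * S x
  apply_self : ∀ x, D x x = S x
  tangent : ∀ x y, S x + ρ * D x (y - x) ≤ S y
  lipschitz : ∀ x y, D y (y - x) - D x (y - x) ≤
    κ / 2 * ((S x ^ ((ρ - 2) / ρ) + S y ^ ((ρ - 2) / ρ)) * S (y - x) ^ (2 / ρ))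
  continuous : Continuous D

namespace IsPowerPotential

variable {V : Type*} [NormedAddCommGroup V] [NormedSpace ℝ V] {ρ κ : ℝ}
  {S : V → ℝ} {D : V → V →L[ℝ] ℝ}

lemma zero (h : IsPowerPotential ρ κ S D) : S 0 = 0 := by
  rw [← h.apply_self, map_zero]

lemma pos (h : IsPowerPotential ρ κ S D) {x : V} (hx : x ≠ 0) : 0 < S x :=
  (h.nonneg x).lt_of_ne fun h0 => hx (h.eq_zero x h0.symm)

lemma sq_rpow (h : IsPowerPotential ρ κ S D) (x : V) : (S x ^ (1 / ρ)) ^ 2 = S x ^ (2 / ρ) := by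
  rw [← Real.rpow_mul_natCast (h.nonneg x)]
  congr 1
  push_cast
  ring

lemma root_rpow (h : IsPowerPotential ρ κ S D) (hρ : 2 ≤ ρ) (x : V) :
    (S x ^ (1 / ρ)) ^ ρ = S x := by
  rw [← Real.rpow_mul (h.nonneg x), one_div_mul_cancel (by linarith), Real.rpow_one]

lemma root_smul (h : IsPowerPotential ρ κ S D) (hρ : 2 ≤ ρ) (c : ℝ) (x : V) :
    S (c • x) ^ (1 / ρ) = |c| * S x ^ (1 / ρ) := by
  rw [h.smul, Real.mul_rpow (by positivity) (h.nonneg x), ← Real.rpow_mul (abs_nonneg c),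
    mul_one_div_cancel (by linarith), Real.rpow_one]

lemma convex (h : IsPowerPotential ρ κ S D) (x y : V) {s t : ℝ} (hs : 0 ≤ s) (ht : 0 ≤ t)
    (hst : s + t = 1) : S (s • x + t • y) ≤ s * S x + t * S y := by
  set z := s • x + t • y with hz
  have h1 := mul_le_mul_of_nonneg_left (h.tangent z x) hs
  have h2 := mul_le_mul_of_nonneg_left (h.tangent z y) ht
  have h3 : s * D z (x - z) + t * D z (y - z) = 0 := by
    rw [← smul_eq_mul, ← smul_eq_mul, ← map_smul, ← map_smul, ← map_add]
    have : s • (x - z) + t • (y - z) = 0 := by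
      rw [smul_sub, smul_sub, sub_add_sub_comm, ← hz, ← add_smul, hst, one_smul, sub_self]
    rw [this, map_zero]
  have h4 : s * S z + t * S z = S z := by rw [← add_mul, hst, one_mul]
  have h5 : ρ * (s * D z (x - z) + t * D z (y - z)) = 0 := by rw [h3, mul_zero]
  linarith

/-- The triangle inequality is convexity of the unit ball: `x + y`, divided by the sum of the two
norms, is a convex combination of the normalized vectors. -/
lemma isNorm (h : IsPowerPotential ρ κ S D) (hρ : 2 ≤ ρ) :
    IsNorm (fun x => S x ^ (1 / ρ)) where
  add_le x y := by
    have hρ0 : 0 < ρ := by linarith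
    have e0 : (0 : ℝ) ^ (1 / ρ) = 0 := Real.zero_rpow (by positivity)
    by_cases hx : x = 0
    · simp [hx, h.zero, hρ0.ne']
    by_cases hy : y = 0
    · simp [hy, h.zero, hρ0.ne']
    have ha : 0 < S x ^ (1 / ρ) := Real.rpow_pos_of_pos (h.pos hx) _
    have hb : 0 < S y ^ (1 / ρ) := Real.rpow_pos_of_pos (h.pos hy) _
    have hab := add_pos ha hb
    have unit : ∀ w, w ≠ 0 → S ((S w ^ (1 / ρ))⁻¹ • w) = 1 := by
      intro w hw
      have hw' : 0 < S w ^ (1 / ρ) := Real.rpow_pos_of_pos (h.pos hw) _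
      rw [h.smul, abs_of_pos (by positivity), Real.inv_rpow hw'.le, h.root_rpow hρ,
        inv_mul_cancel₀ (h.pos hw).ne']
    have key := h.convex ((S x ^ (1 / ρ))⁻¹ • x) ((S y ^ (1 / ρ))⁻¹ • y)
      (s := S x ^ (1 / ρ) / (S x ^ (1 / ρ) + S y ^ (1 / ρ)))
      (t := S y ^ (1 / ρ) / (S x ^ (1 / ρ) + S y ^ (1 / ρ))) (by positivity) (by positivity)
      (by field_simp)
    rw [unit x hx, unit y hy, smul_smul, smul_smul, div_mul_eq_mul_div, div_mul_eq_mul_div,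
      mul_inv_cancel₀ ha.ne', mul_inv_cancel₀ hb.ne', ← smul_add, h.smul,
      abs_of_pos (by positivity), Real.div_rpow zero_le_one hab.le, Real.one_rpow, mul_one, mul_one,
      ← add_div, div_self hab.ne', div_mul_eq_mul_div, one_mul,
      div_le_one (Real.rpow_pos_of_pos hab _)] at key
    calc S (x + y) ^ (1 / ρ) ≤ ((S x ^ (1 / ρ) + S y ^ (1 / ρ)) ^ ρ) ^ (1 / ρ) :=
          Real.rpow_le_rpow (h.nonneg _) key (by positivity)
      _ = _ := by
          rw [← Real.rpow_mul hab.le, mul_one_div_cancel hρ0.ne', Real.rpow_one]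
  smul_eq c x := h.root_smul hρ c x
  eq_zero x hx := by
    rw [Real.rpow_eq_zero (h.nonneg x) (by positivity)] at hx
    exact h.eq_zero x hx

/-- The tangent inequalities at `x` and at `y` trap the remainder between 0 and `ρ * (D y - D x) (y
- x)`, which is `o(‖y - x‖)` by continuity of `D`. -/
lemma hasFDerivAt (h : IsPowerPotential ρ κ S D) (hρ : 2 ≤ ρ) (x : V) :
    HasFDerivAt S (ρ • D x) x := by
  rw [hasFDerivAt_iff_isLittleO]
  have h1 : (fun y => S y - S x - (ρ • D x) (y - x)) =O[𝓝 x]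
      fun y => ‖D y - D x‖ * ‖y - x‖ := by
    refine IsBigO.of_bound ρ (Eventually.of_forall fun y => ?_)
    have t1 := h.tangent x y
    have t2 := h.tangent y x
    have t3 : (D y - D x) (y - x) ≤ ‖D y - D x‖ * ‖y - x‖ :=
      (le_abs_self _).trans ((D y - D x).le_opNorm _)
    have t4 : D y (x - y) = - D y (y - x) := by rw [← map_neg, neg_sub]
    rw [_root_.sub_apply] at t3
    have t5 : 0 ≤ ‖D y - D x‖ * ‖y - x‖ := by positivity
    rw [Real.norm_of_nonneg t5, _root_.smul_apply, smul_eq_mul,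
      Real.norm_of_nonneg (by linarith)]
    rw [t4] at t2
    nlinarith
  refine h1.trans_isLittleO ?_
  have h2 : Tendsto (fun y => ‖D y - D x‖) (𝓝 x) (𝓝 0) := by
    have : Continuous fun y => ‖D y - D x‖ := (h.continuous.sub continuous_const).norm
    simpa using this.tendsto x
  have h3 : (fun y => ‖D y - D x‖) =o[𝓝 x] (fun _ => (1 : ℝ)) := (isLittleO_one_iff ℝ).2 h2
  simpa using (h3.mul_isBigO (isBigO_refl (fun y => ‖y - x‖) (𝓝 x))).norm_right

lemma deriv_zero (h : IsPowerPotential ρ κ S D) (hρ : 2 ≤ ρ) : D 0 = 0 := by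
  have hmin : IsLocalMin S 0 := Eventually.of_forall fun y => by
    rw [h.zero]
    exact h.nonneg y
  have h1 := hmin.hasFDerivAt_eq_zero (h.hasFDerivAt hρ 0)
  exact (smul_eq_zero.1 h1).resolve_left (by linarith)

lemma continuous_potential (h : IsPowerPotential ρ κ S D) (hρ : 2 ≤ ρ) : Continuous S :=
  continuous_iff_continuousAt.2 fun x => (h.hasFDerivAt hρ x).continuousAt

lemma exists_le [FiniteDimensional ℝ V] (h : IsPowerPotential ρ κ S D) (hρ : 2 ≤ ρ) :
    ∃ C, ∀ x, S x ≤ C * ‖x‖ ^ ρ := by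
  obtain ⟨C, hC⟩ := (isCompact_sphere (0 : V) 1).exists_bound_of_continuousOn
    (h.continuous_potential hρ).continuousOn
  refine ⟨C, fun x => ?_⟩
  by_cases hx : x = 0
  · simp [hx, h.zero, (by linarith : ρ ≠ 0)]
  have hx' : 0 < ‖x‖ := norm_pos_iff.2 hx
  have h1 := (le_abs_self _).trans (hC (‖x‖⁻¹ • x) (by simp [norm_smul, hx'.ne']))
  rw [h.smul, abs_of_pos (by positivity), Real.inv_rpow hx'.le, inv_mul_le_iff₀ (by positivity)]
    at h1
  linarith

/-- The derivative of `S ^ (2 / ρ)`. -/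
lemma hasFDerivAt_sq [FiniteDimensional ℝ V] (h : IsPowerPotential ρ κ S D) (hρ : 2 ≤ ρ) (x : V) :
    HasFDerivAt (fun x => (S x ^ (1 / ρ)) ^ 2) ((2 * S x ^ (2 / ρ - 1)) • D x) x := by
  have hρ0 : 0 < ρ := by linarith
  simp only [h.sq_rpow]
  by_cases hx : x = 0
  · subst hx
    rw [h.deriv_zero hρ, smul_zero]
    obtain ⟨C, hC⟩ := h.exists_le hρ
    -- At the origin the chain rule for the power may fail; instead homogeneity makes the function
    -- `O(‖y‖ ^ 2)`, so its derivative is 0.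
    refine Asymptotics.IsBigO.hasFDerivAt (n := 2) ?_ one_lt_two
    refine IsBigO.of_bound (|C| ^ (2 / ρ)) (Eventually.of_forall fun y => ?_)
    rw [Real.norm_of_nonneg (Real.rpow_nonneg (h.nonneg y) _), sub_zero, norm_pow, norm_norm]
    have hy : S y ≤ |C| * ‖y‖ ^ ρ :=
      (hC y).trans (mul_le_mul_of_nonneg_right (le_abs_self C) (by positivity))
    refine (Real.rpow_le_rpow (h.nonneg y) hy (by positivity)).trans (le_of_eq ?_)
    rw [Real.mul_rpow (abs_nonneg C) (by positivity), ← Real.rpow_mul (norm_nonneg y),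
      mul_div_cancel₀ _ hρ0.ne', Real.rpow_two]
  · have := (h.hasFDerivAt hρ x).rpow_const (p := 2 / ρ) (Or.inl (h.pos hx).ne')
    rw [smul_smul] at this
    convert this using 2
    field_simp

/-- Rescale `z` to the norm of `x` and use the tangent inequality at `x`. The constant is crude; the
bound serves only to show that the derivative of the squared norm is continuous at 0. -/
lemma abs_apply_le (h : IsPowerPotential ρ κ S D) (hρ : 2 ≤ ρ) {x z : V} (hx : x ≠ 0)
    (hz : z ≠ 0) : |D x z| ≤ 2 ^ ρ / ρ * S x ^ (1 - 1 / ρ) * S z ^ (1 / ρ) := by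
  have hρ0 : 0 < ρ := by linarith
  have upper : ∀ z, z ≠ 0 → D x z ≤ 2 ^ ρ / ρ * S x ^ (1 - 1 / ρ) * S z ^ (1 / ρ) := by
    intro z hz
    have ha : 0 < S x ^ (1 / ρ) := Real.rpow_pos_of_pos (h.pos hx) _
    have hb : 0 < S z ^ (1 / ρ) := Real.rpow_pos_of_pos (h.pos hz) _
    set c := S x ^ (1 / ρ) / S z ^ (1 / ρ) with hc
    have hc0 : 0 < c := by positivity
    have t1 := h.tangent x (x + c • z)
    have t2 : S (x + c • z) ^ (1 / ρ) ≤ 2 * S x ^ (1 / ρ) := by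
      refine ((h.isNorm hρ).add_le x (c • z)).trans (le_of_eq ?_)
      rw [h.root_smul hρ, abs_of_pos hc0, hc, div_mul_cancel₀ _ hb.ne']
      ring
    have t3 : S (x + c • z) ≤ 2 ^ ρ * S x := by
      rw [← h.root_rpow hρ (x + c • z)]
      refine (Real.rpow_le_rpow (Real.rpow_nonneg (h.nonneg _) _) t2 hρ0.le).trans (le_of_eq ?_)
      rw [Real.mul_rpow zero_le_two ha.le, h.root_rpow hρ]
    rw [add_sub_cancel_left, map_smul, smul_eq_mul] at t1
    have t4 : ρ * (c * D x z) ≤ 2 ^ ρ * S x := by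
      have := h.nonneg x
      linarith
    rw [Real.rpow_sub (h.pos hx), Real.rpow_one, ← mul_le_mul_iff_right₀ (by positivity : 0 < ρ * c)]
    calc ρ * c * D x z = ρ * (c * D x z) := by ring
      _ ≤ 2 ^ ρ * S x := t4
      _ = _ := by
        rw [hc]
        field_simp
  rw [abs_le']
  refine ⟨upper z hz, ?_⟩
  have := upper (-z) (neg_ne_zero.2 hz)
  rw [map_neg] at this
  have e : S (-z) = S z := by
    have := h.smul (-1) z
    simpa using this
  rwa [e] at this

lemma contDiff_sq [FiniteDimensional ℝ V] (h : IsPowerPotential ρ κ S D) (hρ : 2 ≤ ρ) :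
    ContDiff ℝ 1 (fun x => (S x ^ (1 / ρ)) ^ 2) := by
  have hρ0 : 0 < ρ := by linarith
  rw [contDiff_one_iff_fderiv]
  refine ⟨fun x => (h.hasFDerivAt_sq hρ x).differentiableAt, ?_⟩
  have e : fderiv ℝ (fun x => (S x ^ (1 / ρ)) ^ 2) = fun x => (2 * S x ^ (2 / ρ - 1)) • D x :=
    funext fun x => (h.hasFDerivAt_sq hρ x).fderiv
  rw [e, continuous_clm_apply]
  intro z
  rw [continuous_iff_continuousAt]
  intro x
  have hS := (h.continuous_potential hρ).continuousAt (x := x)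
  by_cases hx : x = 0
  · subst hx
    have hD0 : ((2 * S 0 ^ (2 / ρ - 1)) • D 0) z = 0 := by
      rw [h.deriv_zero hρ, smul_zero, _root_.zero_apply]
    by_cases hz : z = 0
    · simp only [hz, map_zero]
      exact continuousAt_const
    rw [ContinuousAt, hD0]
    have lim : Tendsto (fun x => 2 * (2 ^ ρ / ρ) * S z ^ (1 / ρ) * S x ^ (1 / ρ)) (𝓝 0) (𝓝 0) := by
      have := (hS.rpow_const (p := 1 / ρ) (Or.inr (by positivity))).const_mul
        (2 * (2 ^ ρ / ρ) * S z ^ (1 / ρ))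
      rw [ContinuousAt, h.zero, Real.zero_rpow (by positivity), mul_zero] at this
      exact this
    refine squeeze_zero_norm (fun x => ?_) lim
    by_cases hx : x = 0
    · rw [hx, hD0, norm_zero, h.zero]
      have := h.nonneg z
      positivity
    · have hx' := h.pos hx
      rw [_root_.smul_apply, norm_smul, Real.norm_of_nonneg (by positivity),
        Real.norm_eq_abs]
      refine (mul_le_mul_of_nonneg_left (h.abs_apply_le hρ hx hz) (by positivity)).trans
        (le_of_eq ?_)
      have : S x ^ (1 / ρ) = S x ^ (2 / ρ - 1) * S x ^ (1 - 1 / ρ) := by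
        rw [← Real.rpow_add hx']
        congr 1; ring
      rw [this]
      ring
  · have hD : ContinuousAt (fun x => D x z) x :=
      ((continuous_clm_apply.1 h.continuous) z).continuousAt
    simp only [_root_.smul_apply, smul_eq_mul]
    exact ((hS.rpow_const (Or.inl (h.pos hx).ne')).const_mul 2).mul hD

/-- The increment of the derivative of `S ^ (2 / ρ)` along a line avoiding the origin. -/
lemma deriv_along_line_le (h : IsPowerPotential ρ κ S D) (hρ : 2 ≤ ρ) {x y : V}
    (hxy : ∀ t : ℝ, x + t • y ≠ 0) {t : ℝ} (ht : t ∈ Set.Icc (0 : ℝ) 1) :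
    2 * S (x + t • y) ^ (2 / ρ - 1) * D (x + t • y) y ≤
      2 * S x ^ (2 / ρ - 1) * D x y + 2 * κ * S y ^ (2 / ρ) * t := by
  have hρ0 : 0 < ρ := by linarith
  set e := 2 / ρ - 1 with he
  have he0 : e ≤ 0 := by
    rw [he, sub_nonpos, div_le_one hρ0]
    exact hρ
  have hee : (ρ - 2) / ρ = -e := by rw [he]; field_simp; ring
  have hline : ∀ s : ℝ, HasDerivAt (fun s : ℝ => x + s • y) y s := fun s => by
    simpa using ((hasDerivAt_id s).smul_const y).const_add x
  have hS : ∀ s : ℝ, HasDerivAt (fun s : ℝ => S (x + s • y)) (ρ * D (x + s • y) y) s := fun s => by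
    have := (h.hasFDerivAt hρ (x + s • y)).comp_hasDerivAt s (hline s)
    exact this
  have hpos : ∀ s : ℝ, 0 < S (x + s • y) := fun s => h.pos (hxy s)
  have hSe : ∀ s : ℝ, HasDerivAt (fun s : ℝ => S (x + s • y) ^ e)
      (ρ * D (x + s • y) y * e * S (x + s • y) ^ (e - 1)) s := fun s =>
    (hS s).rpow_const (Or.inl (hpos s).ne')
  have hDc : Continuous fun s : ℝ => D (x + s • y) y := by
    exact ((ContinuousLinearMap.apply ℝ ℝ y).continuous.comp h.continuous).comp (by fun_prop)
  have hSc : Continuous fun s : ℝ => S (x + s • y) ^ e :=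
    continuous_iff_continuousAt.2 fun s => (hSe s).continuousAt
  -- `D` need not be differentiable along the line, so the growth is controlled through right lower
  -- slopes.
  have key := image_le_of_liminf_slope_right_le_deriv_boundary
    (f := fun s : ℝ => 2 * S (x + s • y) ^ e * D (x + s • y) y) (a := 0) (b := 1)
    (B := fun s => 2 * S x ^ e * D x y + 2 * κ * S y ^ (2 / ρ) * s)
    (B' := fun _ => 2 * κ * S y ^ (2 / ρ))
    ((continuous_const.mul hSc).mul hDc).continuousOn (by simp)
    (by fun_prop)
    (fun s _ => by
      simpa using (((hasDerivAt_id s).const_mul (2 * κ * S y ^ (2 / ρ))).const_add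
        (2 * S x ^ e * D x y)).hasDerivWithinAt)
    ?_ ht
  · exact key
  intro s _ r hr
  apply Eventually.frequently
  -- This majorant of the slope comes from a discrete product rule. Its first part tends to `2 * κ *
  -- S y ^ (2 / ρ)`; the limit of the second is nonpositive because `e ≤ 0`.
  have lim : Tendsto (fun z => κ * S y ^ (2 / ρ) * (S (x + z • y) ^ e * S (x + s • y) ^ (-e) + 1) +
      2 * D (x + s • y) y * slope (fun s : ℝ => S (x + s • y) ^ e) s z) (𝓝[>] s)
      (𝓝 (κ * S y ^ (2 / ρ) * (S (x + s • y) ^ e * S (x + s • y) ^ (-e) + 1) +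
      2 * D (x + s • y) y * (ρ * D (x + s • y) y * e * S (x + s • y) ^ (e - 1)))) := by
    refine Tendsto.add (((((hSc.tendsto s).mono_left nhdsWithin_le_nhds).mul_const _).add_const
      _).const_mul _) (Tendsto.const_mul _ ?_)
    exact (hasDerivAt_iff_tendsto_slope.1 (hSe s)).mono_left
      (nhdsWithin_mono _ fun z hz => (Set.mem_Ioi.1 hz).ne')
  have hlt : κ * S y ^ (2 / ρ) * (S (x + s • y) ^ e * S (x + s • y) ^ (-e) + 1) +
      2 * D (x + s • y) y * (ρ * D (x + s • y) y * e * S (x + s • y) ^ (e - 1)) < r := by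
    rw [← Real.rpow_add (hpos s), add_neg_cancel, Real.rpow_zero]
    have h1 : 0 ≤ D (x + s • y) y ^ 2 * S (x + s • y) ^ (e - 1) * ρ := by
      have := hpos s
      positivity
    nlinarith
  filter_upwards [lim.eventually (gt_mem_nhds hlt), self_mem_nhdsWithin] with z hz hzs
  rw [Set.mem_Ioi] at hzs
  refine lt_of_le_of_lt ?_ hz
  have hzs' : 0 < z - s := sub_pos.2 hzs
  have h1 := h.lipschitz (x + s • y) (x + z • y)
  have h2 : x + z • y - (x + s • y) = (z - s) • y := by rw [sub_smul]; abel
  rw [h2, map_smul, map_smul, h.smul, Real.mul_rpow (by positivity) (h.nonneg y),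
    ← Real.rpow_mul (abs_nonneg _), mul_div_cancel₀ _ hρ0.ne', Real.rpow_two, sq_abs, hee,
    smul_eq_mul, smul_eq_mul] at h1
  have h3 : D (x + z • y) y - D (x + s • y) y ≤ κ / 2 *
      (S (x + s • y) ^ (-e) + S (x + z • y) ^ (-e)) * S y ^ (2 / ρ) * (z - s) := by
    rw [← mul_le_mul_iff_right₀ hzs']
    linarith
  have h4 : 2 * S (x + z • y) ^ e * (D (x + z • y) y - D (x + s • y) y) ≤
      κ * S y ^ (2 / ρ) * (S (x + z • y) ^ e * S (x + s • y) ^ (-e) + 1) * (z - s) := by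
    have hp : 0 ≤ 2 * S (x + z • y) ^ e := by
      have := hpos z
      positivity
    refine (mul_le_mul_of_nonneg_left h3 hp).trans (le_of_eq ?_)
    have h5 : S (x + z • y) ^ e * S (x + z • y) ^ (-e) = 1 := by
      rw [← Real.rpow_add (hpos z), add_neg_cancel, Real.rpow_zero]
    linear_combination κ * S y ^ (2 / ρ) * (z - s) * h5
  simp only [slope_def_field]
  rw [← mul_le_mul_iff_left₀ hzs', add_mul, div_mul_cancel₀ _ hzs'.ne', mul_assoc (2 * _),
    div_mul_cancel₀ _ hzs'.ne']
  linarith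

theorem isSmoothNorm [FiniteDimensional ℝ V] (h : IsPowerPotential ρ κ S D) (hρ : 2 ≤ ρ)
    (hκ : 1 ≤ κ) : IsSmoothNorm κ (fun x => S x ^ (1 / ρ)) where
  one_le := hκ
  isNorm := h.isNorm hρ
  contDiff := h.contDiff_sq hρ
  le x y := by
    have hρ0 : 0 < ρ := by linarith
    rw [(h.hasFDerivAt_sq hρ x).fderiv, _root_.smul_apply, smul_eq_mul]
    -- Off the origin, integrate the bound on the derivative over `[0, 1]`. Otherwise `x = 0` or `y
    -- = c • x`, and the claim reduces to `1 ≤ κ`.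
    by_cases hxy : ∀ t : ℝ, x + t • y ≠ 0
    · have hline : ∀ s : ℝ, HasDerivAt (fun s : ℝ => x + s • y) y s := fun s => by
        simpa using ((hasDerivAt_id s).smul_const y).const_add x
      have hd : ∀ s : ℝ, HasDerivAt (fun s : ℝ => (S (x + s • y) ^ (1 / ρ)) ^ 2)
          (2 * S (x + s • y) ^ (2 / ρ - 1) * D (x + s • y) y) s := fun s => by
        have := (h.hasFDerivAt_sq hρ (x + s • y)).comp_hasDerivAt s (hline s)
        exact this
      have key := image_le_of_deriv_right_le_deriv_boundary
        (f := fun s : ℝ => (S (x + s • y) ^ (1 / ρ)) ^ 2) (a := 0) (b := 1)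
        (B := fun s => (S x ^ (1 / ρ)) ^ 2 + 2 * S x ^ (2 / ρ - 1) * D x y * s +
          κ * S y ^ (2 / ρ) * s ^ 2)
        (B' := fun s => 2 * S x ^ (2 / ρ - 1) * D x y + 2 * κ * S y ^ (2 / ρ) * s)
        (fun s _ => (hd s).continuousAt.continuousWithinAt) (fun s _ => (hd s).hasDerivWithinAt)
        (by simp) (by fun_prop)
        (fun s _ => by
          have h1 := ((hasDerivAt_id s).const_mul (2 * S x ^ (2 / ρ - 1) * D x y)).const_add
            ((S x ^ (1 / ρ)) ^ 2)
          have h2 := ((hasDerivAt_id s).pow 2).const_mul (κ * S y ^ (2 / ρ))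
          refine HasDerivAt.hasDerivWithinAt ((h1.add h2).congr_deriv ?_)
          simp
          ring)
        (fun s hs => h.deriv_along_line_le hρ hxy (Set.Ico_subset_Icc_self hs))
        (Set.right_mem_Icc.2 zero_le_one)
      rw [h.sq_rpow y]
      simpa using key
    · push Not at hxy
      obtain ⟨t, ht⟩ := hxy
      by_cases hx : x = 0
      · subst hx
        rw [h.deriv_zero hρ, _root_.zero_apply, zero_add, h.zero,
          Real.zero_rpow (by positivity : 1 / ρ ≠ 0)]
        nlinarith [sq_nonneg (S y ^ (1 / ρ))]
      · have ht0 : t ≠ 0 := by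
          rintro rfl
          simp [hx] at ht
        obtain ⟨c, rfl⟩ : ∃ c : ℝ, y = c • x := by
          refine ⟨-t⁻¹, ?_⟩
          rw [eq_neg_of_add_eq_zero_left ht, smul_neg, neg_smul, neg_neg, smul_smul,
            inv_mul_cancel₀ ht0, one_smul]
        have e1 : x + c • x = (1 + c) • x := by rw [add_smul, one_smul]
        have e2 : S x ^ (2 / ρ - 1) * S x = (S x ^ (1 / ρ)) ^ 2 := by
          rw [h.sq_rpow, Real.rpow_sub_one (h.pos hx).ne', div_mul_cancel₀ _ (h.pos hx).ne']
        rw [e1, h.root_smul hρ, h.root_smul hρ, map_smul, h.apply_self, smul_eq_mul, mul_pow,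
          mul_pow, sq_abs, sq_abs, mul_assoc 2, mul_left_comm _ c, e2]
        have := mul_nonneg (mul_nonneg (sub_nonneg.2 hκ) (sq_nonneg c))
          (sq_nonneg (S x ^ (1 / ρ)))
        linarith

end IsPowerPotential

end Potential

/-! ### Symmetric dilation, singular values and the operator norm. -/

section Operators

open Filter Topology
open scoped RealInnerProductSpace

lemma traceRpow_congr {E : Type*} [NormedAddCommGroup E] [InnerProductSpace ℝ E]
    [FiniteDimensional ℝ E] (ρ : ℝ) {X Y : E →ₗ[ℝ] E} (h : X = Y) (hX : X.IsSymmetric)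
    (hY : Y.IsSymmetric) : traceRpow ρ hX = traceRpow ρ hY := by
  subst h
  rfl

/-- `tr |L x| ^ ρ` is a power potential, for an injective linear family `L` of symmetric
operators. -/
lemma isPowerPotential_traceRpow {V E : Type*} [NormedAddCommGroup V] [NormedSpace ℝ V]
    [FiniteDimensional ℝ V] [NormedAddCommGroup E] [InnerProductSpace ℝ E]
    [FiniteDimensional ℝ E] {ρ : ℝ} (hρ : 2 ≤ ρ) (L : V →ₗ[ℝ] E →ₗ[ℝ] E)
    (hL : ∀ x, (L x).IsSymmetric) (hinj : Function.Injective L) :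
    IsPowerPotential ρ (max 2 (ρ - 1)) (fun x => traceRpow ρ (hL x))
      (fun x => LinearMap.toContinuousLinearMap (traceDeriv ρ (hL x) ∘ₗ L)) where
  nonneg x := traceRpow_nonneg ρ (hL x)
  eq_zero x hx := by
    rw [traceRpow_eq_zero_iff (by linarith)] at hx
    exact (map_eq_zero_iff L hinj).1 hx
  smul c x := by
    have h : (c • L x).IsSymmetric := by
      rw [← map_smul]
      exact hL _
    rw [← traceRpow_smul (hL x) c h]
    exact traceRpow_congr ρ (map_smul L c x) _ _
  apply_self x := traceDeriv_self hρ (hL x)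
  tangent x y := by
    simpa using traceRpow_add_le hρ (hL x) (hL y)
  lipschitz x y := by
    have h := traceDeriv_sub_le hρ (hL x) (hL y) ((hL y).sub (hL x))
    rw [traceRpow_congr ρ (map_sub L y x).symm _ (hL (y - x))] at h
    simpa using h
  continuous := by
    rw [continuous_clm_apply]
    intro z
    rw [continuous_iff_continuousAt]
    intro x
    have hρ2 : 0 ≤ ρ - 2 := by linarith
    have hc : Continuous fun y => (L y).toContinuousLinearMap :=
      ((LinearMap.toContinuousLinearMap : (E →ₗ[ℝ] E) ≃ₗ[ℝ] (E →L[ℝ] E)).toLinearMap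
        ∘ₗ L).continuous_of_finiteDimensional
    have hc' : Continuous fun y => (L y - L x).toContinuousLinearMap := by
      simp only [map_sub]
      exact hc.sub continuous_const
    have lim : Tendsto (fun y => (Module.finrank ℝ E : ℝ) * (Module.finrank ℝ E *
        (max 2 (ρ - 1) / 2 * (‖(L x).toContinuousLinearMap‖ ^ (ρ - 2) +
          ‖(L y).toContinuousLinearMap‖ ^ (ρ - 2)) *
        ‖(L y - L x).toContinuousLinearMap‖ * ‖(L z).toContinuousLinearMap‖))) (𝓝 x) (𝓝 0) := by
      have : Continuous (fun y => (Module.finrank ℝ E : ℝ) * (Module.finrank ℝ E *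
        (max 2 (ρ - 1) / 2 * (‖(L x).toContinuousLinearMap‖ ^ (ρ - 2) +
          ‖(L y).toContinuousLinearMap‖ ^ (ρ - 2)) *
        ‖(L y - L x).toContinuousLinearMap‖ * ‖(L z).toContinuousLinearMap‖))) :=
        continuous_const.mul (continuous_const.mul (((continuous_const.mul (continuous_const.add
          (hc.norm.rpow_const fun _ => Or.inr hρ2))).mul hc'.norm).mul continuous_const))
      simpa using this.tendsto x
    rw [ContinuousAt, tendsto_iff_norm_sub_tendsto_zero]
    exact squeeze_zero (fun _ => norm_nonneg _)
      (fun y => abs_traceDeriv_sub_le hρ (hL x) (hL y) (L z)) lim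

variable {E F : Type*} [NormedAddCommGroup E] [InnerProductSpace ℝ E] [FiniteDimensional ℝ E]
  [NormedAddCommGroup F] [InnerProductSpace ℝ F] [FiniteDimensional ℝ F]

/-- The symmetric dilation `(f, e) ↦ (T e, T* f)` of `T`. -/
noncomputable def dilation :
    (E →ₗ[ℝ] F) →ₗ[ℝ] WithLp 2 (F × E) →ₗ[ℝ] WithLp 2 (F × E) where
  toFun T := (WithLp.linearEquiv 2 ℝ (F × E)).symm.toLinearMap ∘ₗ
    (T ∘ₗ LinearMap.snd ℝ F E).prod (T.adjoint ∘ₗ LinearMap.fst ℝ F E) ∘ₗ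
    (WithLp.linearEquiv 2 ℝ (F × E)).toLinearMap
  map_add' S T := by
    ext x
    simp
    rfl
  map_smul' c T := by
    ext x
    simp
    rfl

lemma dilation_apply (T : E →ₗ[ℝ] F) (w : WithLp 2 (F × E)) :
    dilation T w = WithLp.toLp 2 (T w.snd, T.adjoint w.fst) := rfl

lemma isSymmetric_dilation (T : E →ₗ[ℝ] F) : (dilation T).IsSymmetric := by
  intro x y
  simp only [dilation_apply, WithLp.prod_inner_apply]
  rw [LinearMap.adjoint_inner_left, LinearMap.adjoint_inner_right, add_comm]
  rfl

lemma dilation_injective : Function.Injective (dilation (E := E) (F := F)) := by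
  intro S T h
  ext x
  have := congrArg (fun f => (f (WithLp.toLp 2 ((0 : F), x))).fst) h
  exact this

lemma adjoint_comp_self_eigenvectorBasis (T : E →ₗ[ℝ] F) (i : Fin (Module.finrank ℝ E)) :
    T.adjoint (T (T.isSymmetric_adjoint_comp_self.eigenvectorBasis rfl i)) =
      T.singularValues i ^ 2 • T.isSymmetric_adjoint_comp_self.eigenvectorBasis rfl i := by
  rw [T.sq_singularValues_fin rfl]
  exact apply_eigenvectorBasis' T.isSymmetric_adjoint_comp_self i

/-- No pairing of eigenvalues with singular values is needed. For a nonzero eigenvalue the two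
components of a unit eigenvector have equal norm, whence the factor 2; the second component is then
expanded in an eigenbasis of `T* T`, where a nonzero overlap forces `|a k|` to equal the singular
value. -/
lemma traceRpow_dilation {ρ : ℝ} (hρ : 0 < ρ) (T : E →ₗ[ℝ] F) :
    traceRpow ρ (isSymmetric_dilation T) =
      2 * ∑ i : Fin (Module.finrank ℝ E), T.singularValues i ^ ρ := by
  set hD := isSymmetric_dilation T
  set w := hD.eigenvectorBasis rfl with hw
  set a := hD.eigenvalues rfl with ha
  set v := T.isSymmetric_adjoint_comp_self.eigenvectorBasis rfl with hv
  have h1 : ∀ k, T (w k).snd = a k • (w k).fst := fun k =>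
    congrArg (fun z : WithLp 2 (F × E) => z.fst) (apply_eigenvectorBasis' hD k)
  have h2 : ∀ k, T.adjoint (w k).fst = a k • (w k).snd := fun k =>
    congrArg (fun z : WithLp 2 (F × E) => z.snd) (apply_eigenvectorBasis' hD k)
  have h3 : ∀ k, ‖(w k).fst‖ ^ 2 + ‖(w k).snd‖ ^ 2 = 1 := fun k => by
    have := w.norm_eq_one k
    rw [← WithLp.prod_norm_sq_eq_of_L2, this, one_pow]
  have h4 : ∀ k, |a k| ^ ρ = 2 * (|a k| ^ ρ * ‖(w k).snd‖ ^ 2) := fun k => by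
    by_cases h0 : a k = 0
    · simp [h0, hρ.ne']
    · have e1 : a k * ‖(w k).fst‖ ^ 2 = a k * ‖(w k).snd‖ ^ 2 := by
        rw [← real_inner_self_eq_norm_sq, ← real_inner_self_eq_norm_sq, ← real_inner_smul_left,
          ← real_inner_smul_left, ← h1, ← h2, LinearMap.adjoint_inner_left, real_inner_comm]
      have e2 := mul_left_cancel₀ h0 e1
      have e3 := h3 k
      have e4 : ‖(w k).snd‖ ^ 2 = 1 / 2 := by linarith
      rw [e4]
      ring
  have h5 : ∀ i k, |a k| ^ ρ * ⟪v i, (w k).snd⟫ ^ 2 =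
      T.singularValues i ^ ρ * ⟪v i, (w k).snd⟫ ^ 2 := fun i k => by
    by_cases hz : ⟪v i, (w k).snd⟫ = 0
    · simp [hz]
    have e1 : T.singularValues i ^ 2 * ⟪v i, (w k).snd⟫ = a k ^ 2 * ⟪v i, (w k).snd⟫ := by
      rw [← real_inner_smul_left, ← adjoint_comp_self_eigenvectorBasis,
        LinearMap.adjoint_inner_left, h1, real_inner_smul_right, ← LinearMap.adjoint_inner_right,
        h2, real_inner_smul_right]
      ring
    have e2 := mul_right_cancel₀ hz e1
    rw [← sq_abs (a k), sq_eq_sq₀ (T.singularValues_nonneg i) (abs_nonneg _)] at e2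
    rw [e2]
  -- Parseval's identity for the vector `(0, v i)` in the eigenbasis of the dilation.
  have h6 : ∀ i, ∑ k, ⟪v i, (w k).snd⟫ ^ 2 = 1 := fun i => by
    have := w.sum_sq_inner_left (WithLp.toLp 2 ((0 : F), v i))
    simpa [WithLp.prod_inner_apply, WithLp.prod_norm_sq_eq_of_L2] using this
  calc traceRpow ρ hD = ∑ k, 2 * (|a k| ^ ρ * ‖(w k).snd‖ ^ 2) :=
        Finset.sum_congr rfl fun k _ => h4 k
    _ = 2 * ∑ k, ∑ i, |a k| ^ ρ * ⟪v i, (w k).snd⟫ ^ 2 := by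
        rw [← Finset.mul_sum]
        congr 1
        refine Finset.sum_congr rfl fun k _ => ?_
        rw [← Finset.mul_sum, v.sum_sq_inner_right]
    _ = 2 * ∑ i : Fin (Module.finrank ℝ E), ∑ k, T.singularValues i ^ ρ * ⟪v i, (w k).snd⟫ ^ 2 := by
        rw [Finset.sum_comm]
        simp only [h5]
    _ = _ := by
        simp only [← Finset.mul_sum, h6, mul_one]

lemma norm_apply_sq_eq_sum_singularValues (T : E →ₗ[ℝ] F) (x : E) :
    ‖T x‖ ^ 2 = ∑ i : Fin (Module.finrank ℝ E), T.singularValues i ^ 2 *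
      ⟪x, T.isSymmetric_adjoint_comp_self.eigenvectorBasis rfl i⟫ ^ 2 := by
  rw [← real_inner_self_eq_norm_sq, ← LinearMap.adjoint_inner_right]
  refine (inner_apply_self_eq_sum T.isSymmetric_adjoint_comp_self _
    (apply_eigenvectorBasis' T.isSymmetric_adjoint_comp_self) x).trans ?_
  simp only [T.sq_singularValues_fin rfl]

lemma singularValues_le_opNorm (T : E →ₗ[ℝ] F) (i : ℕ) :
    T.singularValues i ≤ ‖T.toContinuousLinearMap‖ := by
  by_cases hi : i < Module.finrank ℝ E
  · have h := T.toContinuousLinearMap.le_opNorm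
      (T.isSymmetric_adjoint_comp_self.eigenvectorBasis rfl ⟨i, hi⟩)
    rw [OrthonormalBasis.norm_eq_one, mul_one, LinearMap.coe_toContinuousLinearMap'] at h
    refine le_trans (le_of_eq ?_) h
    rw [← sq_eq_sq₀ (T.singularValues_nonneg i) (norm_nonneg _), ← real_inner_self_eq_norm_sq,
      ← LinearMap.adjoint_inner_right, adjoint_comp_self_eigenvectorBasis, real_inner_smul_right,
      real_inner_self_eq_norm_sq, OrthonormalBasis.norm_eq_one]
    simp
  · rw [T.singularValues_of_finrank_le (not_lt.1 hi)]
    exact norm_nonneg _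

lemma opNorm_le_of_singularValues_le (T : E →ₗ[ℝ] F) {M : ℝ} (hM : 0 ≤ M)
    (h : ∀ i, T.singularValues i ≤ M) : ‖T.toContinuousLinearMap‖ ≤ M := by
  refine ContinuousLinearMap.opNorm_le_bound _ hM fun x => ?_
  rw [LinearMap.coe_toContinuousLinearMap']
  refine le_of_sq_le_sq ?_ (by positivity)
  rw [norm_apply_sq_eq_sum_singularValues, mul_pow,
    ← (T.isSymmetric_adjoint_comp_self.eigenvectorBasis rfl).sum_sq_inner_left, Finset.mul_sum]
  exact Finset.sum_le_sum fun i _ => mul_le_mul_of_nonneg_right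
    (pow_le_pow_left₀ (T.singularValues_nonneg i) (h i) 2) (sq_nonneg _)

end Operators

/-! ### Scaling and restriction of smooth norms. -/

section SmoothNorm

variable {V : Type*} [NormedAddCommGroup V] [NormedSpace ℝ V] [FiniteDimensional ℝ V] {κ : ℝ}
  {N : V → ℝ}

lemma IsSmoothNorm.const_mul (h : IsSmoothNorm κ N) {c : ℝ} (hc : 0 < c) :
    IsSmoothNorm κ (fun x => c * N x) where
  one_le := h.one_le
  isNorm :=
    { add_le := fun x y => by
        rw [← mul_add]
        exact mul_le_mul_of_nonneg_left (h.isNorm.add_le x y) hc.le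
      smul_eq := fun a x => by
        rw [h.isNorm.smul_eq]
        ring
      eq_zero := fun x hx => h.isNorm.eq_zero x ((mul_eq_zero.1 hx).resolve_left hc.ne') }
  contDiff := by
    simp only [mul_pow]
    exact contDiff_const.mul h.contDiff
  le x y := by
    simp only [mul_pow]
    have hd : DifferentiableAt ℝ (fun z => N z ^ 2) x := h.contDiff.differentiable (by simp) x
    rw [fderiv_const_mul hd, smul_apply, smul_eq_mul]
    nlinarith [mul_le_mul_of_nonneg_left (h.le x y) (sq_nonneg c)]

lemma IsSmoothNorm.restrict (h : IsSmoothNorm κ N) (W : Submodule ℝ V) :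
    IsSmoothNorm κ (fun x : W => N x) where
  one_le := h.one_le
  isNorm :=
    { add_le := fun x y => h.isNorm.add_le x y
      smul_eq := fun a x => h.isNorm.smul_eq a x
      eq_zero := fun x hx => Subtype.ext (h.isNorm.eq_zero x hx) }
  contDiff := h.contDiff.comp W.subtypeL.contDiff
  le x y := by
    have hd : DifferentiableAt ℝ (fun z => N z ^ 2) (W.subtypeL x) :=
      h.contDiff.differentiable (by simp) x
    have e : fderiv ℝ (fun z : W => N z ^ 2) x =
        (fderiv ℝ (fun z => N z ^ 2) (x : V)).comp W.subtypeL :=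
      (hd.hasFDerivAt.comp x W.subtypeL.hasFDerivAt).fderiv
    rw [e]
    exact h.le x y

end SmoothNorm

/-! ### Comparison of `ℓ_p` norms in finite dimension. -/

section Lp

variable {ι : Type*} [Fintype ι]

lemma norm_toLp_ofReal {ρ : ℝ} (hρ : 0 < ρ) (v : ι → ℝ) :
    ‖WithLp.toLp (ENNReal.ofReal ρ) v‖ = (∑ i, |v i| ^ ρ) ^ (1 / ρ) := by
  have h : (ENNReal.ofReal ρ).toReal = ρ := ENNReal.toReal_ofReal hρ.le
  rw [PiLp.norm_eq_sum (by rwa [h]), h]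
  rfl

lemma abs_le_norm_toLp {ρ : ℝ} (hρ : 0 < ρ) (v : ι → ℝ) (i : ι) :
    |v i| ≤ ‖WithLp.toLp (ENNReal.ofReal ρ) v‖ := by
  rw [norm_toLp_ofReal hρ]
  calc |v i| = (|v i| ^ ρ) ^ (1 / ρ) := by
        rw [← Real.rpow_mul (abs_nonneg _), mul_one_div_cancel hρ.ne', Real.rpow_one]
    _ ≤ _ := Real.rpow_le_rpow (by positivity) (Finset.single_le_sum
        (f := fun i => |v i| ^ ρ) (fun _ _ => by positivity) (Finset.mem_univ i)) (by positivity)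

lemma norm_toLp_ofReal_rpow {ρ : ℝ} (hρ : 0 < ρ) (v : ι → ℝ) :
    ‖WithLp.toLp (ENNReal.ofReal ρ) v‖ ^ ρ = ∑ i, |v i| ^ ρ := by
  rw [norm_toLp_ofReal hρ, ← Real.rpow_mul (Finset.sum_nonneg fun _ _ => by positivity),
    one_div_mul_cancel hρ.ne', Real.rpow_one]

lemma norm_toLp_nonneg {ρ : ℝ} (hρ : 0 < ρ) (v : ι → ℝ) :
    0 ≤ ‖WithLp.toLp (ENNReal.ofReal ρ) v‖ := by
  rw [norm_toLp_ofReal hρ]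
  exact Real.rpow_nonneg (Finset.sum_nonneg fun _ _ => by positivity) _

lemma norm_toLp_anti {ρ q : ℝ} (hρ : 0 < ρ) (hq : ρ ≤ q) (v : ι → ℝ) :
    ‖WithLp.toLp (ENNReal.ofReal q) v‖ ≤ ‖WithLp.toLp (ENNReal.ofReal ρ) v‖ := by
  have hq0 : 0 < q := hρ.trans_le hq
  have h0 := norm_toLp_nonneg hρ v
  rw [← Real.rpow_le_rpow_iff (norm_toLp_nonneg hq0 v) h0 hq0, norm_toLp_ofReal_rpow hq0]
  set R := ‖WithLp.toLp (ENNReal.ofReal ρ) v‖ with hR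
  have e : ∀ t : ℝ, 0 ≤ t → t ^ q = t ^ (q - ρ) * t ^ ρ := fun t ht => by
    rw [← Real.rpow_add_of_nonneg ht (by linarith) hρ.le, sub_add_cancel]
  calc ∑ i, |v i| ^ q ≤ ∑ i, R ^ (q - ρ) * |v i| ^ ρ := by
        refine Finset.sum_le_sum fun i _ => ?_
        rw [e _ (abs_nonneg _)]
        gcongr
        exact abs_le_norm_toLp hρ v i
    _ = R ^ q := by
        rw [← Finset.mul_sum, ← norm_toLp_ofReal_rpow hρ, ← e _ h0]

lemma norm_toLp_le_card_rpow_mul {ρ q : ℝ} (hρ : 0 < ρ) (hq : ρ ≤ q) (v : ι → ℝ) :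
    ‖WithLp.toLp (ENNReal.ofReal ρ) v‖ ≤
      (Fintype.card ι : ℝ) ^ (1 / ρ - 1 / q) * ‖WithLp.toLp (ENNReal.ofReal q) v‖ := by
  have hq0 : 0 < q := hρ.trans_le hq
  rcases isEmpty_or_nonempty ι with hι | hι
  · have := norm_toLp_nonneg hq0 v
    rw [norm_toLp_ofReal hρ, Finset.univ_eq_empty, Finset.sum_empty,
      Real.zero_rpow (by positivity)]
    positivity
  have hd : (0 : ℝ) < Fintype.card ι := by exact_mod_cast Fintype.card_pos
  -- The power mean inequality with exponent `q / ρ ≥ 1`, applied to `|v i| ^ ρ`.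
  have h := Real.rpow_sum_le_const_mul_sum_rpow_of_nonneg (s := Finset.univ)
    (f := fun i => |v i| ^ ρ) (p := q / ρ) (by rwa [le_div_iff₀ hρ, one_mul])
    (fun _ _ => by positivity)
  have e : ∀ i, (|v i| ^ ρ) ^ (q / ρ) = |v i| ^ q := fun i => by
    rw [← Real.rpow_mul (abs_nonneg _), mul_div_cancel₀ _ hρ.ne']
  simp only [e, Finset.card_univ] at h
  have h0 : 0 ≤ ∑ i, |v i| ^ ρ := Finset.sum_nonneg fun _ _ => by positivity
  rw [norm_toLp_ofReal hρ, norm_toLp_ofReal hq0]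
  calc (∑ i, |v i| ^ ρ) ^ (1 / ρ) = ((∑ i, |v i| ^ ρ) ^ (q / ρ)) ^ (1 / q) := by
        rw [← Real.rpow_mul h0]
        congr 1
        field_simp
    _ ≤ ((Fintype.card ι : ℝ) ^ (q / ρ - 1) * ∑ i, |v i| ^ q) ^ (1 / q) :=
        Real.rpow_le_rpow (by positivity) h (by positivity)
    _ = _ := by
        rw [Real.mul_rpow (by positivity) (Finset.sum_nonneg fun _ _ => by positivity),
          ← Real.rpow_mul hd.le]
        congr 2
        field_simp

lemma norm_toLp_top_le [Nonempty ι] {ρ : ℝ} (hρ : 0 < ρ) (v : ι → ℝ) :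
    ‖WithLp.toLp ∞ v‖ ≤ ‖WithLp.toLp (ENNReal.ofReal ρ) v‖ := by
  rw [PiLp.norm_eq_ciSup]
  exact ciSup_le fun i => abs_le_norm_toLp hρ v i

lemma abs_le_norm_toLp_top (v : ι → ℝ) (i : ι) : |v i| ≤ ‖WithLp.toLp ∞ v‖ := by
  rw [PiLp.norm_eq_ciSup]
  exact le_ciSup (f := fun i => ‖v i‖) (Set.finite_range _).bddAbove i

lemma norm_toLp_le_card_rpow_mul_top [Nonempty ι] {ρ : ℝ} (hρ : 0 < ρ) (v : ι → ℝ) :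
    ‖WithLp.toLp (ENNReal.ofReal ρ) v‖ ≤
      (Fintype.card ι : ℝ) ^ (1 / ρ) * ‖WithLp.toLp ∞ v‖ := by
  have h0 : 0 ≤ ‖WithLp.toLp ∞ v‖ := norm_nonneg _
  rw [norm_toLp_ofReal hρ]
  calc (∑ i, |v i| ^ ρ) ^ (1 / ρ) ≤ (∑ _i : ι, ‖WithLp.toLp ∞ v‖ ^ ρ) ^ (1 / ρ) := by
        refine Real.rpow_le_rpow (Finset.sum_nonneg fun _ _ => by positivity)
          (Finset.sum_le_sum fun i _ => ?_) (by positivity)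
        exact Real.rpow_le_rpow (abs_nonneg _) (abs_le_norm_toLp_top v i) hρ.le
    _ = _ := by
        rw [Finset.sum_const, Finset.card_univ, nsmul_eq_mul,
          Real.mul_rpow (by positivity) (by positivity), ← Real.rpow_mul h0,
          mul_one_div_cancel hρ.ne', Real.rpow_one]

/-- Comparison of the `ℓ_p` and `ℓ_ρ` norms for `ρ ≤ p ≤ ∞`. -/
lemma norm_toLp_sq_compare [Nonempty ι] {ρ : ℝ} (hρ : 0 < ρ) {p : ℝ≥0∞}
    (hp : ENNReal.ofReal ρ ≤ p) (v : ι → ℝ) :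
    ‖WithLp.toLp p v‖ ^ 2 ≤ ‖WithLp.toLp (ENNReal.ofReal ρ) v‖ ^ 2 ∧
    ‖WithLp.toLp (ENNReal.ofReal ρ) v‖ ^ 2 ≤
      (Fintype.card ι : ℝ) ^ (2 / ρ - (2 / p).toReal) * ‖WithLp.toLp p v‖ ^ 2 := by
  have hd : (0 : ℝ) < Fintype.card ι := by exact_mod_cast Fintype.card_pos
  have hsq : ∀ t : ℝ, (Fintype.card ι : ℝ) ^ (2 * t) = ((Fintype.card ι : ℝ) ^ t) ^ 2 := fun t => by
    rw [← Real.rpow_mul_natCast hd.le]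
    congr 1
    push_cast
    ring
  have h0 := norm_toLp_nonneg hρ v
  rcases eq_or_ne p ∞ with rfl | hpt
  · have h1 : 0 ≤ ‖WithLp.toLp ∞ v‖ := norm_nonneg _
    refine ⟨pow_le_pow_left₀ h1 (norm_toLp_top_le hρ v) 2, ?_⟩
    rw [ENNReal.div_top, ENNReal.toReal_zero, sub_zero, ← mul_one_div, hsq, ← mul_pow]
    exact pow_le_pow_left₀ h0 (norm_toLp_le_card_rpow_mul_top hρ v) 2
  · obtain ⟨q, hq⟩ : ∃ q : ℝ, q = p.toReal := ⟨_, rfl⟩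
    have hle : ρ ≤ q := by rwa [hq, ← ENNReal.ofReal_le_iff_le_toReal hpt]
    have hq0 := hρ.trans_le hle
    have hpq : p = ENNReal.ofReal q := by rw [hq, ENNReal.ofReal_toReal hpt]
    have e : (2 / p).toReal = 2 / q := by rw [ENNReal.toReal_div, ← hq]; rfl
    rw [e, hpq]
    refine ⟨pow_le_pow_left₀ (norm_toLp_nonneg hq0 v) (norm_toLp_anti hρ hle v) 2, ?_⟩
    rw [← mul_one_div, ← mul_one_div 2 q, ← mul_sub, hsq, ← mul_pow]
    exact pow_le_pow_left₀ h0 (norm_toLp_le_card_rpow_mul hρ hle v) 2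

end Lp

/-! ### Schatten norms as norms of dilations. -/

section Schatten

variable {m n : ℕ}

lemma singularValues_eq_zero_of_min_le (X : Matrix (Fin m) (Fin n) ℝ) {i : ℕ}
    (hi : min m n ≤ i) : (Matrix.toEuclideanLin X).singularValues i = 0 := by
  rw [LinearMap.singularValues_eq_zero_iff_le_finrank_range]
  refine le_trans (le_min ?_ ?_) hi
  · simpa using (LinearMap.range (Matrix.toEuclideanLin X)).finrank_le
  · simpa using LinearMap.finrank_range_le (Matrix.toEuclideanLin X)

/-- The singular values beyond index `min m n` vanish by the rank bound, so extending the sum to all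
`n` indices adds only zeros. -/
lemma sum_singularVec_rpow {ρ : ℝ} (hρ : 0 < ρ) (X : Matrix (Fin m) (Fin n) ℝ) :
    ∑ i, |singularVec X i| ^ ρ =
      ∑ i : Fin (Module.finrank ℝ (EuclideanSpace ℝ (Fin n))),
        (Matrix.toEuclideanLin X).singularValues i ^ ρ := by
  have e : ∀ i, |singularVec X i| = (Matrix.toEuclideanLin X).singularValues i := fun i =>
    abs_of_nonneg (LinearMap.singularValues_nonneg _ _)
  simp only [e]
  rw [Fin.sum_univ_eq_sum_range (fun i => (Matrix.toEuclideanLin X).singularValues i ^ ρ),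
    Fin.sum_univ_eq_sum_range (fun i => (Matrix.toEuclideanLin X).singularValues i ^ ρ),
    finrank_euclideanSpace_fin]
  refine Finset.sum_subset (Finset.range_mono (min_le_right m n)) fun i _ hi => ?_
  rw [singularValues_eq_zero_of_min_le X (not_lt.1 (Finset.mem_range.not.1 hi)), Real.zero_rpow hρ.ne']

lemma schattenNorm_ofReal {ρ : ℝ} (hρ : 0 < ρ) (X : Matrix (Fin m) (Fin n) ℝ) :
    schattenNorm (ENNReal.ofReal ρ) X = (1 / 2) ^ (1 / ρ) *
      traceRpow ρ (isSymmetric_dilation (Matrix.toEuclideanLin X)) ^ (1 / ρ) := by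
  rw [schattenNorm, norm_toLp_ofReal hρ, sum_singularVec_rpow hρ,
    ← Real.mul_rpow (by norm_num) (traceRpow_nonneg _ _), traceRpow_dilation hρ]
  congr 1
  ring

theorem isSmoothNorm_schattenNorm {ρ : ℝ} (hρ : 2 ≤ ρ) :
    IsSmoothNorm (max 2 (ρ - 1))
      (fun X : Matrix (Fin m) (Fin n) ℝ => schattenNorm (ENNReal.ofReal ρ) X) := by
  have h := (isPowerPotential_traceRpow (V := Matrix (Fin m) (Fin n) ℝ) hρ
    (dilation ∘ₗ (Matrix.toEuclideanLin (𝕜 := ℝ) (m := Fin m) (n := Fin n)).toLinearMap)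
    (fun X => isSymmetric_dilation (Matrix.toEuclideanLin X))
    (dilation_injective.comp (LinearEquiv.injective _))).isSmoothNorm hρ
    (one_le_two.trans (le_max_left _ _))
  have h' := h.const_mul (c := (1 / 2) ^ (1 / ρ)) (by positivity)
  simp only [schattenNorm_ofReal (by linarith : 0 < ρ)]
  exact h'

/-- Supplies the norm axioms at `p = ∞`, where the smooth-norm theorem does not apply. -/
lemma schattenNorm_top [Nonempty (Fin (min m n))] (X : Matrix (Fin m) (Fin n) ℝ) :
    schattenNorm ∞ X = ‖(Matrix.toEuclideanLin X).toContinuousLinearMap‖ := by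
  refine le_antisymm ?_ (opNorm_le_of_singularValues_le _ (norm_nonneg _) fun i => ?_)
  · rw [schattenNorm, PiLp.norm_eq_ciSup]
    refine ciSup_le fun i => ?_
    refine le_trans (le_of_eq ?_) (singularValues_le_opNorm (Matrix.toEuclideanLin X) i)
    exact abs_of_nonneg (LinearMap.singularValues_nonneg _ _)
  · by_cases hi : i < min m n
    · exact (le_abs_self _).trans (abs_le_norm_toLp_top (singularVec X) ⟨i, hi⟩)
    · rw [singularValues_eq_zero_of_min_le X (not_lt.1 hi)]
      exact norm_nonneg _

lemma isNorm_schattenNorm [Nonempty (Fin (min m n))] {p : ℝ≥0∞} (hp : 2 ≤ p) :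
    IsNorm (fun X : Matrix (Fin m) (Fin n) ℝ => schattenNorm p X) := by
  rcases eq_or_ne p ∞ with rfl | hpt
  · simp only [schattenNorm_top]
    refine ⟨fun X Y => ?_, fun c X => ?_, fun X hX => ?_⟩
    · rw [map_add, map_add]
      exact norm_add_le _ _
    · rw [map_smul, map_smul, norm_smul, Real.norm_eq_abs]
    · rw [norm_eq_zero] at hX
      simpa using hX
  · have h : 2 ≤ p.toReal := by
      simpa using ENNReal.toReal_mono hpt hp
    rw [← ENNReal.ofReal_toReal hpt]
    exact (isSmoothNorm_schattenNorm h).isNorm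

end Schatten

/-! ### The constant `κ_p(m, n)`: attainment, bounds and regularity. -/

section Kappa

open Set

lemma kappaSet_exists_isLeast {p : ℝ≥0∞} (hp : 2 ≤ p) {m n : ℕ} (hd : 1 ≤ min m n) :
    ∃ k, IsLeast (kappaSet p m n) k := by
  have hd1 : (1 : ℝ) ≤ (min m n : ℕ) := by exact_mod_cast hd
  have hd0 : (0 : ℝ) < (min m n : ℕ) := by linarith
  set f : ℝ → ℝ := fun ρ => max 2 (ρ - 1) * ((min m n : ℕ) : ℝ) ^ (2 / ρ - (2 / p).toReal) with hf
  have hcont : ∀ R, ContinuousOn f (Icc 2 R) := fun R => by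
    refine ((continuous_const.max (by fun_prop)).continuousOn).mul
      (ContinuousOn.rpow continuousOn_const ?_ fun _ _ => Or.inl hd0.ne')
    refine ContinuousOn.sub (continuousOn_const.div continuousOn_id fun x hx => ?_)
      continuousOn_const
    exact (two_pos.trans_le hx.1).ne'
  suffices ∃ ρ : ℝ, 2 ≤ ρ ∧ ENNReal.ofReal ρ ≤ p ∧
      ∀ r : ℝ, 2 ≤ r → ENNReal.ofReal r ≤ p → f ρ ≤ f r by
    obtain ⟨ρ, h1, h2, h3⟩ := this
    refine ⟨f ρ, ⟨ρ, h1, h2, rfl⟩, ?_⟩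
    rintro _ ⟨r, hr1, hr2, rfl⟩
    exact h3 r hr1 hr2
  rcases eq_or_ne p ∞ with rfl | hpt
  · obtain ⟨ρ, hρ, hmin⟩ := isCompact_Icc.exists_isMinOn
      -- With `d = min m n`, the value at 2 is `2 * d`, while beyond `2 * d + 1` the factor `r - 1`
      -- alone exceeds it; the search is thus confined to a compact interval.
      (nonempty_Icc.2 (by linarith : (2 : ℝ) ≤ 2 * (min m n : ℕ) + 1)) (hcont _)
    refine ⟨ρ, hρ.1, le_top, fun r hr _ => ?_⟩
    by_cases hrR : r ≤ 2 * (min m n : ℕ) + 1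
    · exact hmin ⟨hr, hrR⟩
    refine (hmin (left_mem_Icc.2 (by linarith))).trans ?_
    simp only [hf, ENNReal.div_top, ENNReal.toReal_zero, sub_zero]
    have h1 : (1 : ℝ) ≤ ((min m n : ℕ) : ℝ) ^ (2 / r) :=
      Real.one_le_rpow hd1 (by positivity)
    have h2 : max 2 ((2 : ℝ) - 1) = 2 := by norm_num
    rw [h2, div_self two_ne_zero, Real.rpow_one]
    calc (2 : ℝ) * (min m n : ℕ) ≤ r - 1 := by linarith
      _ ≤ max 2 (r - 1) := le_max_right _ _
      _ ≤ _ := le_mul_of_one_le_right (by positivity) h1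
  · have h2 : 2 ≤ p.toReal := by simpa using ENNReal.toReal_mono hpt hp
    obtain ⟨ρ, hρ, hmin⟩ := isCompact_Icc.exists_isMinOn (nonempty_Icc.2 h2) (hcont _)
    refine ⟨ρ, hρ.1, (ENNReal.ofReal_le_iff_le_toReal hpt).2 hρ.2, fun r hr hrp => ?_⟩
    exact hmin ⟨hr, (ENNReal.ofReal_le_iff_le_toReal hpt).1 hrp⟩

lemma isLeast_kappa {p : ℝ≥0∞} (hp : 2 ≤ p) {m n : ℕ} (hd : 1 ≤ min m n) :
    IsLeast (kappaSet p m n) (kappa p m n) := by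
  obtain ⟨k, hk⟩ := kappaSet_exists_isLeast hp hd
  rw [kappa, hk.csInf_eq]
  exact hk

lemma kappa_le_of_le {p : ℝ≥0∞} (hp : 2 ≤ p) {m n : ℕ} (hd : 1 ≤ min m n) {ρ : ℝ} (hρ : 2 ≤ ρ)
    (hρp : ENNReal.ofReal ρ ≤ p) :
    kappa p m n ≤ max 2 (ρ - 1) * ((min m n : ℕ) : ℝ) ^ (2 / ρ - (2 / p).toReal) :=
  (isLeast_kappa hp hd).2 ⟨ρ, hρ, hρp, rfl⟩

lemma kappa_le_max {p : ℝ≥0∞} (hp : 2 ≤ p) (hpt : p ≠ ∞) {m n : ℕ} (hd : 1 ≤ min m n) :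
    kappa p m n ≤ max 2 (p.toReal - 1) := by
  have h2 : 2 ≤ p.toReal := by simpa using ENNReal.toReal_mono hpt hp
  have h := kappa_le_of_le hp hd h2 (ENNReal.ofReal_toReal hpt).le
  rwa [ENNReal.toReal_div, ENNReal.toReal_ofNat, sub_self, Real.rpow_zero, mul_one] at h

lemma one_le_log_add_two {d : ℕ} (hd : 1 ≤ d) : 1 ≤ Real.log ((d : ℝ) + 2) := by
  have hd1 : (1 : ℝ) ≤ d := by exact_mod_cast hd
  rw [Real.le_log_iff_exp_le (by linarith)]
  linarith [Real.exp_one_lt_three]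

/-- For `d ≥ 3` the maximum is its second entry, since `exp (3 / 2) ≤ 5 ≤ d + 2`, and the power is
at most `e`. For `d = 1` the power is 1. For `d = 2` the maximum is 2, but the power is only `exp (1
/ 2)`. -/
lemma max_mul_rpow_le {d : ℕ} (hd : 1 ≤ d) :
    max 2 (2 * Real.log ((d : ℝ) + 2) - 1) * (d : ℝ) ^ (1 / Real.log ((d : ℝ) + 2)) ≤
      (2 * Real.log ((d : ℝ) + 2) - 1) * Real.exp 1 := by
  have hd1 : (1 : ℝ) ≤ d := by exact_mod_cast hd
  have hl := one_le_log_add_two hd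
  have he := Real.exp_one_gt_d9
  have he' := Real.exp_one_lt_d9
  by_cases h3 : 3 ≤ d
  · have h3' : (3 : ℝ) ≤ d := by exact_mod_cast h3
    have hl' : 3 / 2 ≤ Real.log ((d : ℝ) + 2) := by
      rw [Real.le_log_iff_exp_le (by linarith)]
      have h1 : Real.exp (3 / 2) ^ 2 = Real.exp 1 ^ 3 := by
        rw [← Real.exp_nat_mul, ← Real.exp_nat_mul]
        norm_num
      have h2 : Real.exp 1 ^ 3 ≤ 5 ^ 2 :=
        (pow_le_pow_left₀ (Real.exp_pos 1).le he'.le 3).trans (by norm_num)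
      have h4 : Real.exp (3 / 2) ≤ 5 := le_of_sq_le_sq (h1.trans_le h2) (by norm_num)
      linarith
    rw [max_eq_right (by linarith)]
    refine mul_le_mul_of_nonneg_left ?_ (by linarith)
    calc (d : ℝ) ^ (1 / Real.log ((d : ℝ) + 2))
        ≤ ((d : ℝ) + 2) ^ (1 / Real.log ((d : ℝ) + 2)) :=
          Real.rpow_le_rpow (by linarith) (by linarith) (by positivity)
      _ = Real.exp 1 := by
          rw [Real.rpow_def_of_pos (by linarith), mul_one_div_cancel (by linarith)]
  · have : d = 1 ∨ d = 2 := by omega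
    rcases this with rfl | rfl
    · rw [Nat.cast_one, Real.one_rpow, mul_one]
      rw [Nat.cast_one] at hl
      apply max_le <;> nlinarith
    · have h4 : Real.log (((2 : ℕ) : ℝ) + 2) = 2 * Real.log 2 := by
        rw [← Real.log_rpow two_pos]
        norm_num
      have hl1 := Real.log_two_gt_d9
      have hl2 := Real.log_two_lt_d9
      rw [h4, max_eq_left (by linarith), Nat.cast_ofNat, Real.rpow_def_of_pos two_pos]
      have h5 : Real.log 2 * (1 / (2 * Real.log 2)) = 1 / 2 := by field_simp
      have h6 : Real.exp 1 = Real.exp (1 / 2) * Real.exp (1 / 2) := by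
        rw [← Real.exp_add]
        norm_num
      have h7 := Real.add_one_le_exp (1 / 2 : ℝ)
      rw [h5, h6, ← mul_assoc]
      refine mul_le_mul_of_nonneg_right ?_ (Real.exp_pos _).le
      nlinarith

lemma kappa_le_log {p : ℝ≥0∞} (hp : 2 ≤ p) {m n : ℕ} (hd : 1 ≤ min m n) :
    kappa p m n ≤ (2 * Real.log (((min m n : ℕ) : ℝ) + 2) - 1) * Real.exp 1 := by
  have hd1 : (1 : ℝ) ≤ (min m n : ℕ) := by exact_mod_cast hd
  have hl := one_le_log_add_two hd
  have he := Real.exp_one_gt_d9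
  -- If `ρ = 2 ln(d + 2)` is not admissible, then `p` is smaller than it and the choice `ρ = p`
  -- already gives the bound, using `2 ≤ e`.
  by_cases h : ENNReal.ofReal (2 * Real.log (((min m n : ℕ) : ℝ) + 2)) ≤ p
  · refine (kappa_le_of_le hp hd (by linarith) h).trans (le_trans ?_ (max_mul_rpow_le hd))
    refine mul_le_mul_of_nonneg_left (Real.rpow_le_rpow_of_exponent_le hd1 ?_) (by positivity)
    rw [div_mul_eq_div_div, div_self two_ne_zero]
    linarith [ENNReal.toReal_nonneg (a := 2 / p)]
  · have hpt : p ≠ ∞ := by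
      rintro rfl
      exact h le_top
    rw [ENNReal.ofReal_le_iff_le_toReal hpt, not_le] at h
    refine (kappa_le_max hp hpt hd).trans (max_le ?_ ?_) <;> nlinarith

lemma ofReal_kappa_le {p : ℝ≥0∞} (hp : 2 ≤ p) {m n : ℕ} (hd : 1 ≤ min m n) :
    ENNReal.ofReal (kappa p m n) ≤ min (max 2 (p - 1))
      (ENNReal.ofReal ((2 * Real.log (((min m n : ℕ) : ℝ) + 2) - 1) * Real.exp 1)) := by
  refine le_min ?_ (ENNReal.ofReal_le_ofReal (kappa_le_log hp hd))
  rcases eq_or_ne p ∞ with rfl | hpt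
  · simp
  · refine (ENNReal.ofReal_le_ofReal (kappa_le_max hp hpt hd)).trans (le_of_eq ?_)
    rw [ENNReal.ofReal_max, ENNReal.ofReal_sub _ zero_le_one, ENNReal.ofReal_toReal hpt,
      ENNReal.ofReal_one, ENNReal.ofReal_ofNat]

theorem isRegularNorm_schattenNorm {p : ℝ≥0∞} (hp : 2 ≤ p) {m n : ℕ} (hd : 1 ≤ min m n) :
    IsRegularNorm (kappa p m n) (fun X : Matrix (Fin m) (Fin n) ℝ => schattenNorm p X) := by
  have hd1 : (1 : ℝ) ≤ (min m n : ℕ) := by exact_mod_cast hd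
  have : Nonempty (Fin (min m n)) := ⟨⟨0, hd⟩⟩
  obtain ⟨ρ, hρ, hρp, hk⟩ := (isLeast_kappa hp hd).1
  have hρ0 : 0 < ρ := by linarith
  have hm : (1 : ℝ) ≤ max 2 (ρ - 1) := one_le_two.trans (le_max_left _ _)
  have hexp : 0 ≤ 2 / ρ - (2 / p).toReal := by
    have h1 : 2 / p ≤ 2 / ENNReal.ofReal ρ := ENNReal.div_le_div_left hρp 2
    have h2 := ENNReal.toReal_mono
      (ENNReal.div_ne_top (by simp) (by simpa using hρ0)) h1
    rw [ENNReal.toReal_div 2 (ENNReal.ofReal ρ), ENNReal.toReal_ofReal hρ0.le,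
      ENNReal.toReal_ofNat] at h2
    linarith
  have hle : max 2 (ρ - 1) ≤ kappa p m n := by
    rw [hk]
    exact le_mul_of_one_le_right (by positivity) (Real.one_le_rpow hd1 hexp)
  -- The smooth norm is the Schatten norm at the minimizing `ρ`; the ratio `κ / κ'` is then exactly
  -- the comparison factor between the squared `ℓ_ρ` and `ℓ_p` norms.
  refine ⟨hm.trans hle, isNorm_schattenNorm hp, max 2 (ρ - 1), hm, hle, _,
    isSmoothNorm_schattenNorm hρ, fun X => ?_⟩
  rw [hk, mul_div_cancel_left₀ _ (by positivity)]
  have := norm_toLp_sq_compare hρ0 hρp (singularVec X)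
  rwa [Fintype.card_fin] at this

end Kappa

end RegularSpaces

theorem mainTheorem3 :
    (∀ (m n : ℕ), 1 ≤ m → 1 ≤ n → ∀ p : ℝ≥0∞, 2 ≤ p →
      IsLeast (RegularSpaces.kappaSet p m n) (RegularSpaces.kappa p m n) ∧
      RegularSpaces.IsRegularNorm (RegularSpaces.kappa p m n)
        (fun X : Matrix (Fin m) (Fin n) ℝ => RegularSpaces.schattenNorm p X) ∧
      ENNReal.ofReal (RegularSpaces.kappa p m n) ≤
        min (max 2 (p - 1))
          (ENNReal.ofReal ((2 * Real.log (((min m n : ℕ) : ℝ) + 2) - 1) * Real.exp 1))) ∧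
    (∀ (n : ℕ), 1 ≤ n → ∀ ρ : ℝ, 2 ≤ ρ →
      RegularSpaces.IsSmoothNorm (max 2 (ρ - 1))
        (fun X : RegularSpaces.symMatrices n =>
          RegularSpaces.schattenNorm (ENNReal.ofReal ρ)
            (X : Matrix (Fin n) (Fin n) ℝ))) := by
  refine ⟨fun m n hm hn p hp => ?_, fun n _ ρ hρ => ?_⟩
  · have hd : 1 ≤ min m n := le_min hm hn
    exact ⟨RegularSpaces.isLeast_kappa hp hd, RegularSpaces.isRegularNorm_schattenNorm hp hd,
      RegularSpaces.ofReal_kappa_le hp hd⟩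
  · exact (RegularSpaces.isSmoothNorm_schattenNorm (m := n) (n := n) hρ).restrict
      (RegularSpaces.symMatrices n)
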